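/- \textbf{Conventions.} For a cardinal $\kappa$, $H_\kappa$ is the set of all sets whose transitive closure has size less than $\kappa$, and $[A]^\mu$ is the set of subsets of $A$ of size $\mu$. A subset of $[A]^\mu$ (with $\mu\in\{\omega,\omega_1\}$) is stationary if it meets every $C\subseteq[A]^\mu$ that is $\subseteq$-cofinal in $[A]^\mu$ and closed under unions of nonempty $\subseteq$-chains of size at most $\mu$. A sequence $\langle Q_i\mid i<\rho\rangle$ is a continuous $\in$-chain if $Q_i\in Q_{i+1}$ whenever $i+1<\rho$, and $Q_\lambda=\bigcup_{i<\lambda}Q_i$ for every limit $\lambda<\rho$. For a class $\Gamma$ of (nonempty) forcing notions, $\mathsf{FA}(\Gamma)$ says that for every $\mathbb P\in\Gamma$ and every sequence $\langle D_i\mid i<\omega_1\rangle$ of dense subsets of $\mathbb P$ there is a filter $F\subseteq\mathbb P$ with $F\cap D_i\neq\emptyset$ for all $i<\omega_1$. Let $\kappa$ be an uncountable regular cardinal, $\mathcal S$ a nonempty collection of stationary subsets of $[H_\kappa]^\omega$, and $\vec T=\langle T_i\mid i<\omega_1\rangle$ a sequence of pairwise disjoint stationary subsets of $\omega_1$. The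 forcing notion $\mathbb P^{\mathsf{DSRP}}_{\mathcal S,\vec T}$ consists of all pairs $p=\langle\vec Q^p,\vec S^p\rangle$ such that, for some $\delta^p,\lambda^p<\omega_1$: $\vec Q^p=\langle Q^p_\alpha\mid\alpha\le\delta^p\rangle$ is a continuous $\in$-chain of elements of $[H_\kappa]^\omega$; $\vec S^p=\langle S^p_i\mid i<\lambda^p\rangle$ is a sequence of elements of $\mathcal S$; and whenever $\alpha\le\delta^p$ and $\alpha\in T_i$, then $i<\lambda^p$ and $Q^p_\alpha\in S^p_i$. It is ordered by extension of functions in both coordinates. A pair $\langle\vec Q,\vec S\rangle$ is a diagonal chain through $\mathcal S$ up to a set $X$ with respect to $\vec T$ if: $\vec Q=\langle Q_i\mid i<\omega_1\rangle$ is a continuous $\in$-chain of countable subsets of $H_\kappa$; $\vec S=\langle S_i\mid i<\omega_1\rangle$ is a sequence of members of $\mathcal S$ such that $Q_i\in S_j$ whenever $i\in T_j$; $H_\kappa\cap X=\bigcup_{\alpha<\omega_1}Q_\alpha$, and $\langle Q_i\mid i<\alpha\rangle\in H_\kappa\cap X$ for all $\alpha<\omega_1$; and $\mathcal S\cap X=\{S_i\mid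 i<\omega_1\}$. For $\kappa>\omega_1$, $\mathsf{DSRP}(\mathcal S,\vec T)$ says that for every regular cardinal $\theta>2^{<\kappa}$ the set of all $X\in[H_\theta]^{\omega_1}$ such that $\omega_1\subseteq X$ and there is a diagonal chain through $\mathcal S$ up to $X$ with respect to $\vec T$ is stationary in $[H_\theta]^{\omega_1}$. For a class $\Gamma$ of forcing notions, $\Gamma$-$\mathsf{DSRP}$ says that for every regular $\kappa>\omega_1$ and all $\mathcal S,\vec T$ as above with $\mathbb P^{\mathsf{DSRP}}_{\mathcal S,\vec T}\in\Gamma$, the principle $\mathsf{DSRP}(\mathcal S,\vec T)$ holds. \textbf{Statement.} \begin{enumerate} \item For every class $\Gamma$ of forcing notions, $\mathsf{FA}(\Gamma)$ implies $\Gamma$-$\mathsf{DSRP}$. \item Let $\kappa>\omega_1$ be regular and let $\mathcal S,\vec T$ be as above. If $\mathsf{FA}(\{\mathbb P^{\mathsf{DSRP}}_{\mathcal S,\vec T}\})$ holds, then $\mathsf{DSRP}(\mathcal S,\vec T)$ holds. \item Let $\kappa$ be an uncountable regular cardinal, let $\mathcal S,\vec T$ be as above and let $\mathbb P=\mathbb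 P^{\mathsf{DSRP}}_{\mathcal S,\vec T}$. Then the following sets are dense in $\mathbb P$: for every $\gamma<\omega_1$, the set of conditions $p$ with $\delta^p,\lambda^p\ge\gamma$; for every $a\in H_\kappa$, the set of conditions $p$ such that $a\in Q^p_\alpha$ for some $\alpha\le\delta^p$; for every $S\in\mathcal S$, the set of conditions $p$ such that $S^p_i=S$ for some $i<\lambda^p$. \end{enumerate} -/

import Mathlib

open Cardinal Ordinal Order

/-! The set-theoretic universe is `ZFSet.{u}`. Ordinals and cardinals are Mathlib's; the von Neumann
ordinal of `α` is `α.toZFSet`. -/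

universe u

namespace DiagRefl

noncomputable section

/-- The countable ordinals, that is, the elements of `ω₁`. -/
abbrev CtblOrd : Type (u + 1) := Set.Iio (ω₁ : Ordinal.{u})

/-! ### The sets `H_κ` and `[A]^μ` -/

theorem exists_rank_eq {y : ZFSet.{u}} (hy : y.IsTransitive) (z : ZFSet.{u}) :
    z ∈ y → ∀ a < z.rank, ∃ w ∈ y, w.rank = a := by
  induction z using ZFSet.inductionOn with
  | _ z ih =>
    intro hz a ha
    obtain ⟨w, hw, haw⟩ := ZFSet.lt_rank_iff.1 ha
    have hwy : w ∈ y := hy.subset_of_mem hz hw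
    rcases haw.eq_or_lt with h | h
    · exact ⟨w, hwy, h.symm⟩
    · exact ih w hw hwy a h

theorem card_rank_le {y : ZFSet.{u}} (hy : y.IsTransitive) : y.rank.card ≤ y.card := by
  rw [← Cardinal.lift_le.{u + 1}, ← Cardinal.mk_Iio_ordinal, ← ZFSet.cardinalMk_coe_sort]
  refine Cardinal.mk_le_of_surjective
    (f := fun w : y => (⟨w.1.rank, ZFSet.rank_lt_of_mem w.2⟩ : Set.Iio y.rank)) ?_
  rintro ⟨a, ha⟩
  obtain ⟨z, hz, haz⟩ := ZFSet.lt_rank_iff.1 (show a < y.rank from ha)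
  rcases haz.eq_or_lt with h | h
  · exact ⟨⟨z, hz⟩, Subtype.ext h.symm⟩
  · obtain ⟨w, hw, hwa⟩ := exists_rank_eq hy z hz a h
    exact ⟨⟨w, hw⟩, Subtype.ext hwa⟩

/-- The set `H_κ` of all sets whose transitive closure has size less than `κ`, i.e. of all sets
that are contained in a transitive set of size less than `κ`. It is cut out of the level `V_κ` of
the cumulative hierarchy only in order to be a set; see `mem_H`. -/
def H (κ : Cardinal.{u}) : ZFSet.{u} :=
  (ZFSet.vonNeumann κ.ord).sep fun x => ∃ y : ZFSet.{u}, y.IsTransitive ∧ x ⊆ y ∧ y.card < κ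

theorem mem_H {κ : Cardinal.{u}} {x : ZFSet.{u}} :
    x ∈ H κ ↔ ∃ y : ZFSet.{u}, y.IsTransitive ∧ x ⊆ y ∧ y.card < κ := by
  rw [H, ZFSet.mem_sep, and_iff_right_iff_imp]
  rintro ⟨y, hy, hxy, hc⟩
  rw [ZFSet.mem_vonNeumann]
  exact (ZFSet.rank_mono hxy).trans_lt (Cardinal.lt_ord.2 ((card_rank_le hy).trans_lt hc))

/-- `[A]^μ`, the set of all subsets of `A` of size exactly `μ`. -/
def subsetsOfCard (A : ZFSet.{u}) (μ : Cardinal.{u}) : ZFSet.{u} :=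
  A.powerset.sep fun x => x.card = μ

/-! ### Generalized stationarity -/

/-- `C` is closed and unbounded in `[A]^μ`: it is cofinal in `[A]^μ` with respect to inclusion and
closed under unions of nonempty chains of length less than `μ⁺`. -/
structure IsClubIn (A : ZFSet.{u}) (μ : Cardinal.{u}) (C : ZFSet.{u}) : Prop where
  subset : C ⊆ subsetsOfCard A μ
  unbounded : ∀ x ∈ subsetsOfCard A μ, ∃ y ∈ C, x ⊆ y
  closed : ∀ K : ZFSet.{u}, K.Nonempty → K ⊆ C → K.card ≤ μ →
    (∀ x ∈ K, ∀ y ∈ K, x ⊆ y ∨ y ⊆ x) → K.sUnion ∈ C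

/-- `S` is a stationary subset of `[A]^μ`. -/
def IsStationaryIn (A : ZFSet.{u}) (μ : Cardinal.{u}) (S : ZFSet.{u}) : Prop :=
  S ⊆ subsetsOfCard A μ ∧ ∀ C : ZFSet.{u}, IsClubIn A μ C → ∃ x ∈ S, x ∈ C

/-- `𝒮` is a collection of stationary subsets of `[H_κ]^ω`. -/
def IsStationaryFamily (κ : Cardinal.{u}) (𝒮 : ZFSet.{u}) : Prop :=
  ∀ S ∈ 𝒮, IsStationaryIn (H κ) ℵ₀ S

/-- `T` is an `ω₁`-sequence of pairwise disjoint stationary subsets of `ω₁`. -/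
def IsDisjointStationarySeq (T : CtblOrd.{u} → Set CtblOrd.{u}) : Prop :=
  (∀ i, IsStationary (T i)) ∧ ∀ i j, i ≠ j → Disjoint (T i) (T j)

/-! ### Sequences and continuous `∈`-chains -/

/-- The sequence `⟨f i | i < α⟩`, as a set of ordered pairs. -/
def seq (α : Ordinal.{u}) (f : Ordinal.{u} → ZFSet.{u}) : ZFSet.{u} :=
  ZFSet.range fun i : Set.Iio α => ZFSet.pair i.1.toZFSet (f i.1)

/-- `⟨Q i | i < ρ⟩` is a continuous `∈`-chain. -/
def IsContinuousChain (ρ : Ordinal.{u}) (Q : Ordinal.{u} → ZFSet.{u}) : Prop :=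
  (∀ i, i + 1 < ρ → Q i ∈ Q (i + 1)) ∧
  ∀ l < ρ, IsSuccLimit l → ∀ x, x ∈ Q l ↔ ∃ i < l, x ∈ Q i

/-- `⟨⟨Q i | i < ω₁⟩, ⟨S i | i < ω₁⟩⟩` is a diagonal chain through `𝒮` (a collection of stationary
subsets of `[H_κ]^ω`) up to `X` with respect to `T`. -/
structure IsDiagonalChain (κ : Cardinal.{u}) (𝒮 : ZFSet.{u})
    (T : CtblOrd.{u} → Set CtblOrd.{u}) (X : ZFSet.{u})
    (Q S : Ordinal.{u} → ZFSet.{u}) : Prop where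
  countable : ∀ i < ω₁, Q i ⊆ H κ ∧ (Q i).card ≤ ℵ₀
  chain : IsContinuousChain ω₁ Q
  mem_family : ∀ i < ω₁, S i ∈ 𝒮
  diagonal : ∀ i j : CtblOrd.{u}, i ∈ T j → Q i ∈ S j
  union : ∀ x, x ∈ H κ ∩ X ↔ ∃ i < ω₁, x ∈ Q i
  initial : ∀ i < ω₁, seq i Q ∈ H κ ∩ X
  range : ∀ s, s ∈ 𝒮 ∩ X ↔ ∃ i < ω₁, S i = s

/-! ### Forcing notions and forcing axioms -/

/-- A forcing notion: a set with a preorder, where `le q p` says that `q` is stronger than `p`. -/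
structure ForcingNotion : Type (u + 1) where
  carrier : ZFSet.{u}
  le : carrier → carrier → Prop
  refl : ∀ p, le p p
  trans : ∀ p q r, le p q → le q r → le p r

namespace ForcingNotion

variable (P : ForcingNotion.{u})

/-- `D` is dense in `P`. -/
def IsDense (D : Set P.carrier) : Prop := ∀ p, ∃ q ∈ D, P.le q p

/-- `F` is a filter in `P`. -/
structure IsFilter (F : Set P.carrier) : Prop where
  nonempty : F.Nonempty
  upward : ∀ p ∈ F, ∀ q, P.le p q → q ∈ F
  directed : ∀ p ∈ F, ∀ q ∈ F, ∃ r ∈ F, P.le r p ∧ P.le r q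

end ForcingNotion

/-- The forcing axiom `FA(Γ)` for a class `Γ` of forcing notions. As usual, a forcing notion is
understood to be nonempty. -/
def FA (Γ : Set ForcingNotion.{u}) : Prop :=
  ∀ P ∈ Γ, P.carrier.Nonempty → ∀ D : CtblOrd.{u} → Set P.carrier, (∀ i, P.IsDense (D i)) →
    ∃ F : Set P.carrier, P.IsFilter F ∧ ∀ i, (F ∩ D i).Nonempty

/-! ### The forcing to add a diagonal chain -/

/-- The pair of `⟨Q α | α ≤ δ⟩` and `⟨S i | i < l⟩` is a condition. -/
structure IsConditionData (κ : Cardinal.{u}) (𝒮 : ZFSet.{u})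
    (T : CtblOrd.{u} → Set CtblOrd.{u}) (δ l : Ordinal.{u})
    (Q S : Ordinal.{u} → ZFSet.{u}) : Prop where
  lt₁ : δ < ω₁
  lt₂ : l < ω₁
  mem : ∀ α ≤ δ, Q α ∈ subsetsOfCard (H κ) ℵ₀
  chain : IsContinuousChain (δ + 1) Q
  mem_family : ∀ i < l, S i ∈ 𝒮
  diagonal : ∀ α i : CtblOrd.{u}, α.1 ≤ δ → α ∈ T i → i.1 < l ∧ Q α ∈ S i

/-- The condition given by `⟨Q α | α ≤ δ⟩` and `⟨S i | i < l⟩`. -/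
def condition (δ l : Ordinal.{u}) (Q S : Ordinal.{u} → ZFSet.{u}) : ZFSet.{u} :=
  ZFSet.pair (seq (δ + 1) Q) (seq l S)

/-- The set of conditions of the forcing to add a diagonal chain; see `mem_conditions`. -/
def conditions (κ : Cardinal.{u}) (𝒮 : ZFSet.{u})
    (T : CtblOrd.{u} → Set CtblOrd.{u}) : ZFSet.{u} :=
  (ZFSet.prod
    (ZFSet.prod (ω₁ : Ordinal.{u}).toZFSet (subsetsOfCard (H κ) ℵ₀)).powerset
    (ZFSet.prod (ω₁ : Ordinal.{u}).toZFSet 𝒮).powerset).sep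
    fun p => ∃ δ l Q S, IsConditionData κ 𝒮 T δ l Q S ∧ p = condition δ l Q S

theorem seq_mem_powerset {α β : Ordinal.{u}} {f : Ordinal.{u} → ZFSet.{u}} {B : ZFSet.{u}}
    (hα : α ≤ β) (hf : ∀ i < α, f i ∈ B) :
    seq α f ∈ (ZFSet.prod β.toZFSet B).powerset := by
  rw [ZFSet.mem_powerset]
  intro z hz
  obtain ⟨⟨i, hi⟩, rfl⟩ := ZFSet.mem_range.1 hz
  exact ZFSet.pair_mem_prod.2
    ⟨Ordinal.toZFSet_mem_toZFSet_iff.2 (lt_of_lt_of_le hi hα), hf i hi⟩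

theorem mem_conditions {κ : Cardinal.{u}} {𝒮 : ZFSet.{u}}
    {T : CtblOrd.{u} → Set CtblOrd.{u}} {p : ZFSet.{u}} :
    p ∈ conditions κ 𝒮 T ↔
      ∃ δ l Q S, IsConditionData κ 𝒮 T δ l Q S ∧ p = condition δ l Q S := by
  rw [conditions, ZFSet.mem_sep, and_iff_right_iff_imp]
  rintro ⟨δ, l, Q, S, h, rfl⟩
  refine ZFSet.pair_mem_prod.2 ⟨seq_mem_powerset ?_ ?_, seq_mem_powerset h.lt₂.le h.mem_family⟩
  · exact Order.add_one_le_of_lt h.lt₁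
  · exact fun i hi => h.mem i (Order.lt_add_one_iff.1 hi)

/-- The forcing notion `ℙ^DSRP_{𝒮,T}` to add a diagonal chain through `𝒮` with respect to `T`,
ordered by extension of functions in both coordinates. -/
def dsrpForcing (κ : Cardinal.{u}) (𝒮 : ZFSet.{u})
    (T : CtblOrd.{u} → Set CtblOrd.{u}) : ForcingNotion.{u} where
  carrier := conditions κ 𝒮 T
  le q p := ∃ a b a' b', q.1 = ZFSet.pair a b ∧ p.1 = ZFSet.pair a' b' ∧ a' ⊆ a ∧ b' ⊆ b
  refl p := by
    obtain ⟨δ, l, Q, S, -, hp⟩ := mem_conditions.1 p.2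
    exact ⟨_, _, _, _, hp, hp, fun _ h => h, fun _ h => h⟩
  trans p q r := by
    rintro ⟨a, b, a', b', hp, hq, h₁, h₂⟩ ⟨c, d, c', d', hq', hr, h₃, h₄⟩
    obtain ⟨rfl, rfl⟩ := ZFSet.pair_inj.1 (hq.symm.trans hq')
    exact ⟨_, _, _, _, hp, hr, fun _ h => h₁ (h₃ h), fun _ h => h₂ (h₄ h)⟩

/-! ### The diagonal strong reflection principle -/

/-- The set of all `X ∈ [H_θ]^ω₁` with `ω₁ ⊆ X` such that there is a diagonal chain through `𝒮` up
to `X` with respect to `T`. -/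
def reflectionSet (κ θ : Cardinal.{u}) (𝒮 : ZFSet.{u})
    (T : CtblOrd.{u} → Set CtblOrd.{u}) : ZFSet.{u} :=
  (subsetsOfCard (H θ) ℵ₁).sep fun X =>
    (ω₁ : Ordinal.{u}).toZFSet ⊆ X ∧ ∃ Q S, IsDiagonalChain κ 𝒮 T X Q S

/-- The principle `DSRP(𝒮, T)`, where `𝒮` is a collection of stationary subsets of `[H_κ]^ω`. The
regular cardinal `θ` is sufficiently large when `2^{<κ} < θ`. -/
def DSRP (κ : Cardinal.{u}) (𝒮 : ZFSet.{u}) (T : CtblOrd.{u} → Set CtblOrd.{u}) : Prop :=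
  ∀ θ : Cardinal.{u}, θ.IsRegular → 2 ^< κ < θ →
    IsStationaryIn (H θ) ℵ₁ (reflectionSet κ θ 𝒮 T)

/-- `⟨𝒮, T⟩` is `Γ`-projective stationary, where `𝒮` is a nonempty collection of stationary subsets
of `[H_κ]^ω` and `T` is an `ω₁`-sequence of pairwise disjoint stationary subsets of `ω₁`. -/
def IsProjectiveStationary (Γ : Set ForcingNotion.{u}) (κ : Cardinal.{u}) (𝒮 : ZFSet.{u})
    (T : CtblOrd.{u} → Set CtblOrd.{u}) : Prop :=
  𝒮.Nonempty ∧ IsStationaryFamily κ 𝒮 ∧ IsDisjointStationarySeq T ∧ dsrpForcing κ 𝒮 T ∈ Γ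

/-- The `Γ`-fragment of the diagonal strong reflection principle at `κ`. -/
def FragmentDSRPAt (Γ : Set ForcingNotion.{u}) (κ : Cardinal.{u}) : Prop :=
  ∀ (𝒮 : ZFSet.{u}) (T : CtblOrd.{u} → Set CtblOrd.{u}),
    IsProjectiveStationary Γ κ 𝒮 T → DSRP κ 𝒮 T

/-- The principle `Γ`-`DSRP`. -/
def FragmentDSRP (Γ : Set ForcingNotion.{u}) : Prop :=
  ∀ κ : Cardinal.{u}, κ.IsRegular → ℵ₁ < κ → FragmentDSRPAt Γ κ

end

end DiagRefl

universe w

namespace DiagRefl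

noncomputable section

/-! ### Cardinalities and the sets `H_κ` -/

theorem card_range_le {ι : Type w} [Small.{u} ι] {f : ι → ZFSet.{u}} {μ : Cardinal.{u}}
    (hι : lift.{u} #ι ≤ lift.{w} μ) : (ZFSet.range f).card ≤ μ :=
  Cardinal.lift_le.1 (ZFSet.lift_card_range_le.trans hι)

theorem card_iUnion_le {ι : Type w} [Small.{u} ι] {f : ι → ZFSet.{u}} {μ : Cardinal.{u}}
    (hμ : ℵ₀ ≤ μ) (hι : lift.{u} #ι ≤ lift.{w} μ) (hf : ∀ i, (f i).card ≤ μ) :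
    (ZFSet.iUnion f).card ≤ μ := by
  have h := (ZFSet.lift_card_iUnion_le_sum_card (f := f)).trans
    (Cardinal.sum_le_sum _ (fun _ => μ) hf)
  rw [Cardinal.sum_const] at h
  rw [← Cardinal.lift_le.{w}]
  refine h.trans ((mul_le_mul_left hι _).trans ?_)
  rw [← Cardinal.lift_mul, mul_eq_self hμ]

theorem card_iUnion_lt {x : ZFSet.{u}} {κ : Cardinal.{u}} {f : ZFSet.{u} → ZFSet.{u}} (hκ : κ.IsRegular)
    (hx : x.card < κ) (hf : ∀ z ∈ x, (f z).card < κ) :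
    (ZFSet.iUnion fun z : x => f z.1).card < κ := by
  have e : ZFSet.iUnion (fun z : x => f z.1)
      = ZFSet.iUnion fun z : Shrink.{u} x => f ((equivShrink x).symm z).1 := by
    ext y
    simp only [ZFSet.mem_iUnion]
    exact ⟨fun ⟨i, hi⟩ => ⟨equivShrink x i, by simpa using hi⟩, fun ⟨i, hi⟩ => ⟨_, hi⟩⟩
  rw [e]
  have h := ZFSet.lift_card_iUnion_le_sum_card
    (f := fun z : Shrink.{u} x => f ((equivShrink x).symm z).1)
  rw [Cardinal.lift_id] at h
  exact h.trans_lt (sum_lt_of_isRegular hκ hx fun i => hf _ ((equivShrink x).symm i).2)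

theorem card_le_aleph0_iff {x : ZFSet.{u}} : x.card ≤ ℵ₀ ↔ (x : Set ZFSet.{u}).Countable := by
  rw [← Cardinal.le_aleph0_iff_set_countable, ← Cardinal.lift_le.{u + 1}, ← ZFSet.cardinalMk_coe_sort,
    lift_aleph0]
  rfl

theorem card_pair_le {a b : ZFSet.{u}} : ({a, b} : ZFSet.{u}).card ≤ ℵ₀ := by
  rw [card_le_aleph0_iff]
  simp

theorem isTransitive_H (κ : Cardinal.{u}) : (H κ).IsTransitive := by
  intro x hx z hz
  obtain ⟨y, hy, hxy, hc⟩ := mem_H.1 hx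
  exact mem_H.2 ⟨y, hy, hy.subset_of_mem (hxy hz), hc⟩

theorem H_mono {κ θ : Cardinal.{u}} (h : κ ≤ θ) : H κ ⊆ H θ := by
  intro x hx
  obtain ⟨y, hy, hxy, hc⟩ := mem_H.1 hx
  exact mem_H.2 ⟨y, hy, hxy, hc.trans_le h⟩

theorem mem_H_of_subset {κ : Cardinal.{u}} (hκ : κ.IsRegular) {x : ZFSet.{u}} (hx : x ⊆ H κ)
    (hc : x.card < κ) : x ∈ H κ := by
  choose! f hf hsub hcard using fun z (hz : z ∈ x) => mem_H.1 (hx hz)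
  refine mem_H.2 ⟨x ∪ ZFSet.iUnion fun z : x => f z.1, ?_, fun z hz => ?_, ?_⟩
  · intro y hy z hz
    rw [ZFSet.mem_union, ZFSet.mem_iUnion] at *
    right
    rcases hy with hy | ⟨i, hi⟩
    · exact ⟨⟨y, hy⟩, hsub y hy hz⟩
    · exact ⟨i, (hf _ i.2).subset_of_mem hi hz⟩
  · exact ZFSet.mem_union.2 (Or.inl hz)
  · exact ZFSet.card_union_le.trans_lt
      (add_lt_of_lt hκ.aleph0_le hc (card_iUnion_lt hκ hc hcard))

theorem empty_mem_H {κ : Cardinal.{u}} (hκ : 0 < κ) : ∅ ∈ H κ :=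
  mem_H.2 ⟨∅, ZFSet.isTransitive_empty, ZFSet.empty_subset _, by rwa [ZFSet.card_empty]⟩

theorem insert_pair_mem_H {κ : Cardinal.{u}} (hκ : κ.IsRegular) (h₀ : ℵ₀ < κ) {a b : ZFSet.{u}}
    (ha : a ∈ H κ) (hb : b ∈ H κ) : ({a, b} : ZFSet.{u}) ∈ H κ := by
  refine mem_H_of_subset hκ (fun z hz => ?_) (card_pair_le.trans_lt h₀)
  rcases ZFSet.mem_pair.1 hz with rfl | rfl <;> assumption

theorem pair_mem_H {κ : Cardinal.{u}} (hκ : κ.IsRegular) (h₀ : ℵ₀ < κ) {a b : ZFSet.{u}}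
    (ha : a ∈ H κ) (hb : b ∈ H κ) : ZFSet.pair a b ∈ H κ := by
  have := insert_pair_mem_H hκ h₀ (insert_pair_mem_H hκ h₀ ha ha) (insert_pair_mem_H hκ h₀ ha hb)
  rwa [ZFSet.pair_eq_singleton] at this

theorem toZFSet_mem_H {κ : Cardinal.{u}} {α : Ordinal.{u}} (h : α.card < κ) : α.toZFSet ∈ H κ :=
  mem_H.2 ⟨_, (ZFSet.isOrdinal_toZFSet α).isTransitive, fun _ h => h,
    by rwa [Ordinal.card_toZFSet]⟩

theorem card_lt_aleph_one {α : Ordinal.{u}} (h : α < ω₁) : α.card ≤ ℵ₀ := by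
  rw [← lt_succ_iff, succ_aleph0, ← Cardinal.lt_ord, ord_aleph]
  exact h

theorem countable_Iio {α : Ordinal.{u}} (h : α < ω₁) : (Set.Iio α).Countable := by
  rw [← Cardinal.le_aleph0_iff_set_countable, Cardinal.mk_Iio_ordinal, ← lift_aleph0.{u + 1, u},
    Cardinal.lift_le]
  exact card_lt_aleph_one h

theorem mem_seq {α : Ordinal.{u}} {f : Ordinal.{u} → ZFSet.{u}} {z : ZFSet.{u}} :
    z ∈ seq α f ↔ ∃ i < α, z = ZFSet.pair i.toZFSet (f i) := by
  rw [seq, ZFSet.mem_range]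
  exact ⟨fun ⟨i, hi⟩ => ⟨i.1, i.2, hi.symm⟩, fun ⟨i, hi, h⟩ => ⟨⟨i, hi⟩, h.symm⟩⟩

theorem seq_subset_seq_iff {α β : Ordinal.{u}} {f g : Ordinal.{u} → ZFSet.{u}} :
    seq α f ⊆ seq β g ↔ ∀ i < α, i < β ∧ f i = g i := by
  constructor
  · intro h i hi
    obtain ⟨j, hj, e⟩ := mem_seq.1 (h (mem_seq.2 ⟨i, hi, rfl⟩))
    obtain ⟨e₁, e₂⟩ := ZFSet.pair_inj.1 e
    obtain rfl := Ordinal.toZFSet_injective e₁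
    exact ⟨hj, e₂⟩
  · intro h z hz
    obtain ⟨i, hi, rfl⟩ := mem_seq.1 hz
    exact mem_seq.2 ⟨i, (h i hi).1, by rw [(h i hi).2]⟩

theorem seq_congr {α : Ordinal.{u}} {f g : Ordinal.{u} → ZFSet.{u}} (h : ∀ i < α, f i = g i) :
    seq α f = seq α g :=
  subset_antisymm (seq_subset_seq_iff.2 fun i hi => ⟨hi, h i hi⟩)
    (seq_subset_seq_iff.2 fun i hi => ⟨hi, (h i hi).symm⟩)

theorem seq_mem_H {κ : Cardinal.{u}} (hκ : κ.IsRegular) (h₀ : ℵ₀ < κ) {α : Ordinal.{u}}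
    {f : Ordinal.{u} → ZFSet.{u}} (hα : α < ω₁) (hf : ∀ i < α, f i ∈ H κ) : seq α f ∈ H κ := by
  refine mem_H_of_subset hκ (fun z hz => ?_) (lt_of_le_of_lt ?_ h₀)
  · obtain ⟨i, hi, rfl⟩ := mem_seq.1 hz
    exact pair_mem_H hκ h₀ (toZFSet_mem_H ((card_lt_aleph_one (hi.trans hα)).trans_lt h₀)) (hf i hi)
  · refine card_range_le ?_
    rw [Cardinal.mk_Iio_ordinal, Cardinal.lift_lift, Cardinal.lift_le]
    exact card_lt_aleph_one hα

theorem mem_subsetsOfCard {A x : ZFSet.{u}} {μ : Cardinal.{u}} :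
    x ∈ subsetsOfCard A μ ↔ x ⊆ A ∧ x.card = μ := by
  rw [subsetsOfCard, ZFSet.mem_sep, ZFSet.mem_powerset]

theorem subsetsOfCard_subset_H {κ : Cardinal.{u}} (hκ : κ.IsRegular) (h₀ : ℵ₀ < κ) :
    subsetsOfCard (H κ) ℵ₀ ⊆ H κ := by
  intro x hx
  obtain ⟨h, hc⟩ := mem_subsetsOfCard.1 hx
  exact mem_H_of_subset hκ h (hc.trans_lt h₀)

theorem exists_countable_closed {α : Type*} (F : α → α → Set α) (hF : ∀ a b, (F a b).Countable)
    {A : Set α} (hA : A.Countable) :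
    ∃ B, A ⊆ B ∧ B.Countable ∧ ∀ a ∈ B, ∀ b ∈ B, F a b ⊆ B := by
  let step : Set α → Set α := fun B => B ∪ ⋃ a ∈ B, ⋃ b ∈ B, F a b
  let I : ℕ → Set α := fun n => step^[n] A
  have hI : ∀ n, I (n + 1) = step (I n) := fun n => Function.iterate_succ_apply' ..
  have hmono : Monotone I := monotone_nat_of_le_succ fun n => by
    rw [hI]; exact Set.subset_union_left
  refine ⟨⋃ n, I n, Set.subset_iUnion I 0, Set.countable_iUnion fun n => ?_, ?_⟩
  · induction n with
    | zero => exact hA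
    | succ n ih =>
      rw [hI]
      exact ih.union (ih.biUnion fun a _ => ih.biUnion fun b _ => hF a b)
  · intro a ha b hb c hc
    obtain ⟨m, hm⟩ := Set.mem_iUnion.1 ha
    obtain ⟨n, hn⟩ := Set.mem_iUnion.1 hb
    refine Set.mem_iUnion.2 ⟨max m n + 1, ?_⟩
    rw [hI]
    exact Or.inr (Set.mem_biUnion (hmono (le_max_left _ _) hm)
      (Set.mem_biUnion (hmono (le_max_right _ _) hn) hc))

theorem mk_ctblOrd : #CtblOrd.{u} = lift.{u + 1} (ℵ₁ : Cardinal.{u}) := by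
  rw [Cardinal.mk_Iio_ordinal, card_omega]

theorem exists_surjective_ctblOrd {ι : Type (u + 1)} [Nonempty ι]
    (h : #ι ≤ lift.{u + 1} (ℵ₁ : Cardinal.{u})) :
    ∃ e : CtblOrd.{u} → ι, Function.Surjective e := by
  rw [← mk_ctblOrd] at h
  obtain ⟨f⟩ := h
  exact ⟨Function.invFun f, Function.invFun_surjective f.injective⟩

/-! ### Closure properties of clubs -/

theorem IsClubIn.iUnion_mem {A C : ZFSet.{u}} {μ : Cardinal.{u}} (hC : IsClubIn A μ C)
    {ι : Type w} [Small.{u} ι] [Nonempty ι] {f : ι → ZFSet.{u}} (hf : ∀ i, f i ∈ C)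
    (hι : lift.{u} #ι ≤ lift.{w} μ) (hchain : ∀ i j, f i ⊆ f j ∨ f j ⊆ f i) :
    ZFSet.iUnion f ∈ C := by
  refine hC.closed (ZFSet.range f) ?_ ?_ (card_range_le hι) ?_
  · obtain ⟨i⟩ := ‹Nonempty ι›
    exact ⟨f i, ZFSet.mem_range_self i⟩
  · intro x hx
    obtain ⟨i, rfl⟩ := ZFSet.mem_range.1 hx
    exact hf i
  · intro x hx y hy
    obtain ⟨i, rfl⟩ := ZFSet.mem_range.1 hx
    obtain ⟨j, rfl⟩ := ZFSet.mem_range.1 hy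
    exact hchain i j

theorem IsClubIn.iUnion_mem_of_countable {A C : ZFSet.{u}} {μ : Cardinal.{u}}
    (hC : IsClubIn A μ C) (hμ : ℵ₀ ≤ μ) {ι : Type w} [Small.{u} ι] [Nonempty ι] [Countable ι]
    {f : ι → ZFSet.{u}} (hf : ∀ i, f i ∈ C) (hdir : Directed (· ⊆ ·) f) :
    ZFSet.iUnion f ∈ C := by
  have := Encodable.ofCountable ι
  have : Inhabited ι := Classical.inhabited_of_nonempty ‹_›
  have hdir' : Directed (· ≤ ·) f := hdir
  have hm := hdir'.sequence_mono
  have e : ZFSet.iUnion f = ZFSet.iUnion fun n => f (hdir'.sequence f n) := by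
    ext z
    simp only [ZFSet.mem_iUnion]
    exact ⟨fun ⟨i, hi⟩ => ⟨_, hdir'.le_sequence i hi⟩, fun ⟨n, hn⟩ => ⟨_, hn⟩⟩
  rw [e]
  refine hC.iUnion_mem (fun n => hf _) (by simpa using hμ) fun m n => ?_
  rcases le_total m n with h | h
  · exact Or.inl (hm h)
  · exact Or.inr (hm h)

theorem IsClubIn.iUnion_mem_of_directed {A C : ZFSet.{u}} (hC : IsClubIn A ℵ₁ C)
    {ι : Type (u + 1)} [Small.{u} ι] [Nonempty ι] (hι : #ι ≤ lift.{u + 1} (ℵ₁ : Cardinal.{u}))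
    {f : ι → ZFSet.{u}} (hf : ∀ i, f i ∈ C) (hdir : Directed (· ⊆ ·) f) :
    ZFSet.iUnion f ∈ C := by
  obtain ⟨e, he⟩ := exists_surjective_ctblOrd hι
  choose ub hub using hdir
  let IsCl : Set ι → Prop := fun B => ∀ i ∈ B, ∀ j ∈ B, ub i j ∈ B
  let cl : CtblOrd.{u} → Set ι := fun ξ => ⋂₀ {B | IsCl B ∧ e '' Set.Iic ξ ⊆ B}
  have hsub : ∀ ξ, e '' Set.Iic ξ ⊆ cl ξ := fun ξ => Set.subset_sInter fun B hB => hB.2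
  have hne : ∀ ξ, Nonempty (cl ξ) := fun ξ => ⟨e ξ, hsub ξ ⟨ξ, Set.self_mem_Iic, rfl⟩⟩
  have hcount : ∀ ξ, Countable (cl ξ) := fun ξ => by
    have hc : (Set.Iic ξ).Countable := by
      have h1 : ξ.1 + 1 < ω₁ := (isSuccLimit_omega 1).succ_lt ξ.2
      have := (countable_Iio h1).preimage (f := ((↑) : CtblOrd.{u} → Ordinal.{u}))
        Subtype.val_injective
      exact this.mono fun η hη => lt_add_one_iff.2 (show η.1 ≤ ξ.1 from hη)
    obtain ⟨B, h₁, h₂, h₃⟩ := exists_countable_closed (fun i j => {ub i j})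
      (fun _ _ => Set.countable_singleton _) (hc.image e)
    have hsubB : cl ξ ⊆ B := Set.sInter_subset_of_mem ⟨fun i hi j hj => h₃ i hi j hj rfl, h₁⟩
    exact (h₂.mono hsubB).to_subtype
  have hcl : ∀ ξ, IsCl (cl ξ) := fun ξ i hi j hj B hB => hB.1 i (hi B hB) j (hj B hB)
  have hmono : ∀ ξ η, ξ ≤ η → cl ξ ⊆ cl η := fun ξ η h i hi B hB =>
    hi B ⟨hB.1, (Set.image_mono (Set.Iic_subset_Iic.2 h)).trans hB.2⟩
  let U : CtblOrd.{u} → ZFSet.{u} := fun ξ => ZFSet.iUnion fun i : cl ξ => f i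
  have hU : ∀ ξ, U ξ ∈ C := fun ξ =>
    hC.iUnion_mem_of_countable (aleph0_le_aleph 1) (fun i => hf i) fun i j =>
      ⟨⟨ub i j, hcl ξ i i.2 j j.2⟩, (hub i j).1, (hub i j).2⟩
  have hUmono : ∀ ξ η, ξ ≤ η → U ξ ⊆ U η := fun ξ η h z hz => by
    obtain ⟨i, hi⟩ := ZFSet.mem_iUnion.1 hz
    exact ZFSet.mem_iUnion.2 ⟨⟨i, hmono ξ η h i.2⟩, hi⟩
  have e' : ZFSet.iUnion f = ZFSet.iUnion U := by
    ext z
    simp only [ZFSet.mem_iUnion, U]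
    constructor
    · rintro ⟨i, hi⟩
      obtain ⟨ξ, rfl⟩ := he i
      exact ⟨ξ, ⟨e ξ, hsub ξ ⟨ξ, Set.self_mem_Iic, rfl⟩⟩, hi⟩
    · rintro ⟨ξ, i, hi⟩
      exact ⟨i, hi⟩
  rw [e']
  have : Nonempty CtblOrd.{u} := ⟨⟨0, omega_pos 1⟩⟩
  refine hC.iUnion_mem hU ?_ fun ξ η => ?_
  · rw [mk_ctblOrd, Cardinal.lift_lift, Cardinal.lift_le.{u + 1}]
  · exact (le_total ξ η).imp (hUmono ξ η) (hUmono η ξ)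

/-! ### Clubs and functions -/

theorem isClubIn_closed {A : ZFSet.{u}} {F : ZFSet.{u} → ZFSet.{u} → ZFSet.{u}}
    (hF : ∀ y a, F y a ⊆ A ∧ (F y a).card ≤ ℵ₀) :
    IsClubIn A ℵ₀ ((subsetsOfCard A ℵ₀).sep fun N => ∀ y ∈ N, ∀ a ∈ N, F y a ⊆ N) := by
  refine ⟨ZFSet.sep_subset, fun x hx => ?_, fun K hK hKC hc hchain => ?_⟩
  · obtain ⟨hxA, hxc⟩ := mem_subsetsOfCard.1 hx
    obtain ⟨B, h₁, h₂, h₃⟩ := exists_countable_closed (fun y a => (F y a : Set ZFSet.{u}))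
      (fun y a => card_le_aleph0_iff.1 (hF y a).2) (card_le_aleph0_iff.1 hxc.le)
    have hxN : x ⊆ A.sep (· ∈ B) := fun z hz => ZFSet.mem_sep.2 ⟨hxA hz, h₁ hz⟩
    refine ⟨A.sep (· ∈ B), ZFSet.mem_sep.2 ⟨mem_subsetsOfCard.2 ⟨ZFSet.sep_subset,
      le_antisymm ?_ ?_⟩, ?_⟩, hxN⟩
    · exact card_le_aleph0_iff.2 (h₂.mono fun z hz => (ZFSet.mem_sep.1 hz).2)
    · exact hxc.symm.le.trans (ZFSet.card_mono hxN)
    · intro y hy a ha z hz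
      exact ZFSet.mem_sep.2 ⟨(hF y a).1 hz,
        h₃ y (ZFSet.mem_sep.1 hy).2 a (ZFSet.mem_sep.1 ha).2 hz⟩
  · have hK' : ∀ x ∈ K, x ⊆ A ∧ x.card = ℵ₀ := fun x hx =>
      mem_subsetsOfCard.1 (ZFSet.mem_sep.1 (hKC hx)).1
    obtain ⟨x₀, hx₀⟩ := hK
    refine ZFSet.mem_sep.2 ⟨mem_subsetsOfCard.2 ⟨fun z hz => ?_, le_antisymm ?_ ?_⟩, ?_⟩
    · obtain ⟨x, hx, hz⟩ := ZFSet.mem_sUnion.1 hz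
      exact (hK' x hx).1 hz
    · rw [card_le_aleph0_iff, ZFSet.coe_sUnion]
      refine ((card_le_aleph0_iff.1 hc).image _).sUnion ?_
      rintro _ ⟨x, hx, rfl⟩
      exact card_le_aleph0_iff.1 (hK' x hx).2.le
    · exact (hK' x₀ hx₀).2.symm.le.trans
        (ZFSet.card_mono fun z hz => ZFSet.mem_sUnion.2 ⟨x₀, hx₀, hz⟩)
    · intro y hy a ha z hz
      obtain ⟨x₁, hx₁, hy⟩ := ZFSet.mem_sUnion.1 hy
      obtain ⟨x₂, hx₂, ha⟩ := ZFSet.mem_sUnion.1 ha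
      rw [ZFSet.mem_sUnion]
      rcases hchain x₁ hx₁ x₂ hx₂ with h | h
      · exact ⟨x₂, hx₂, (ZFSet.mem_sep.1 (hKC hx₂)).2 y (h hy) a ha hz⟩
      · exact ⟨x₁, hx₁, (ZFSet.mem_sep.1 (hKC hx₁)).2 y hy a (h ha) hz⟩

theorem IsStationaryIn.exists_closed {A S : ZFSet.{u}} (hS : IsStationaryIn A ℵ₀ S)
    {F : ZFSet.{u} → ZFSet.{u} → ZFSet.{u}} (hF : ∀ y a, F y a ⊆ A ∧ (F y a).card ≤ ℵ₀) :
    ∃ N ∈ S, ∀ y ∈ N, ∀ a ∈ N, F y a ⊆ N := by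
  obtain ⟨N, hN, hNC⟩ := hS.2 _ (isClubIn_closed hF)
  exact ⟨N, hN, (ZFSet.mem_sep.1 hNC).2⟩

theorem rank_lt_rank_pair (a b : ZFSet.{u}) :
    a.rank < (ZFSet.pair a b).rank ∧ b.rank < (ZFSet.pair a b).rank := by
  rw [ZFSet.pair, ZFSet.rank_pair, ZFSet.rank_pair, ZFSet.rank_singleton]
  exact ⟨lt_max_of_lt_left ((lt_succ _).trans (lt_succ _)), lt_max_of_lt_right
    ((lt_succ _).trans_le ((le_max_right _ _).trans (le_succ _)))⟩

open Classical in
/-- Iterate the ternary operation `nx` along the tree of ordered pairs. -/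
def pairRec (nx : ZFSet.{u} → ZFSet.{u} → ZFSet.{u} → ZFSet.{u}) (c z : ZFSet.{u}) : ZFSet.{u} :=
  if h : ∃ a b, z = ZFSet.pair a b then
    nx (pairRec nx c h.choose) (pairRec nx c h.choose_spec.choose) z
  else nx c c z
termination_by z.rank
decreasing_by
  all_goals
    conv_rhs => rw [h.choose_spec.choose_spec]
  · exact (rank_lt_rank_pair _ _).1
  · exact (rank_lt_rank_pair _ _).2

theorem pairRec_pair (nx : ZFSet.{u} → ZFSet.{u} → ZFSet.{u} → ZFSet.{u}) (c a b : ZFSet.{u}) :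
    pairRec nx c (ZFSet.pair a b) = nx (pairRec nx c a) (pairRec nx c b) (ZFSet.pair a b) := by
  have h : ∃ a' b', ZFSet.pair a b = ZFSet.pair a' b' := ⟨a, b, rfl⟩
  obtain ⟨h₁, h₂⟩ := ZFSet.pair_inj.1 h.choose_spec.choose_spec
  rw [pairRec, dif_pos h]
  exact congr_arg₂ (fun x y => nx (pairRec nx c x) (pairRec nx c y) _) h₁.symm h₂.symm

theorem exists_pair_hull {A C : ZFSet.{u}} (hC : IsClubIn A ℵ₁ C)
    (hne : (subsetsOfCard A ℵ₁).Nonempty) :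
    ∃ g : ZFSet.{u} → ZFSet.{u}, (∀ z, g z ∈ C) ∧ (∀ z ∈ A, z ∈ g z) ∧
      ∀ a b, g a ⊆ g (ZFSet.pair a b) ∧ g b ⊆ g (ZFSet.pair a b) := by
  obtain ⟨x₀, hx₀⟩ := hne
  obtain ⟨c, hc, -⟩ := hC.unbounded x₀ hx₀
  have key : ∀ v z t, ∃ y ∈ C, v ∈ C → z ∈ C → v ⊆ y ∧ z ⊆ y ∧ (t ∈ A → t ∈ y) := by
    intro v z t
    by_cases hvz : v ∈ C ∧ z ∈ C
    swap
    · exact ⟨c, hc, fun hv hz => absurd ⟨hv, hz⟩ hvz⟩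
    obtain ⟨hvA, hvc⟩ := mem_subsetsOfCard.1 (hC.subset hvz.1)
    obtain ⟨hzA, hzc⟩ := mem_subsetsOfCard.1 (hC.subset hvz.2)
    have hmem : v ∪ (z ∪ ZFSet.sep (· ∈ A) {t}) ∈ subsetsOfCard A ℵ₁ := by
      refine mem_subsetsOfCard.2 ⟨fun s hs => ?_, le_antisymm ?_ ?_⟩
      · simp only [ZFSet.mem_union, ZFSet.mem_sep] at hs
        rcases hs with h | h | h
        exacts [hvA h, hzA h, h.2]
      · have hℵ : (ℵ₀ : Cardinal.{u}) ≤ ℵ₁ := aleph0_le_aleph 1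
        refine ZFSet.card_union_le.trans (add_le_of_le hℵ hvc.le
          (ZFSet.card_union_le.trans (add_le_of_le hℵ hzc.le ?_)))
        refine (ZFSet.card_mono ZFSet.sep_subset).trans ?_
        rw [ZFSet.card_singleton]
        exact one_le_aleph0.trans hℵ
      · exact hvc.symm.le.trans (ZFSet.card_mono fun s hs => ZFSet.mem_union.2 (Or.inl hs))
    obtain ⟨y, hy, hxy⟩ := hC.unbounded _ hmem
    refine ⟨y, hy, fun _ _ => ⟨fun s hs => hxy ?_, fun s hs => hxy ?_, fun ht => hxy ?_⟩⟩ <;>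
      simp only [ZFSet.mem_union, ZFSet.mem_sep, ZFSet.mem_singleton] <;> tauto
  choose nx hmem hnx using key
  have hrec : ∀ z, ∃ v ∈ C, ∃ w ∈ C, pairRec nx c z = nx v w z := by
    intro z
    induction z using (InvImage.wf ZFSet.rank wellFounded_lt).induction with
    | _ z ih =>
      by_cases h : ∃ a b, z = ZFSet.pair a b
      · have hr : ∀ z', z'.rank < z.rank → pairRec nx c z' ∈ C := fun z' hz' => by
          obtain ⟨v, -, w, -, e⟩ := ih z' hz'
          exact e ▸ hmem _ _ _
        obtain ⟨a, b, rfl⟩ := h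
        exact ⟨_, hr a (rank_lt_rank_pair a b).1, _, hr b (rank_lt_rank_pair a b).2,
          pairRec_pair ..⟩
      · rw [pairRec, dif_neg h]
        exact ⟨c, hc, c, hc, rfl⟩
  have hC' : ∀ z, pairRec nx c z ∈ C := fun z => by
    obtain ⟨v, -, w, -, e⟩ := hrec z
    exact e ▸ hmem _ _ _
  refine ⟨pairRec nx c, hC', fun z hz => ?_, fun a b => ?_⟩
  · obtain ⟨v, hv, w, hw, e⟩ := hrec z
    exact e ▸ (hnx v w z hv hw).2.2 hz
  · rw [pairRec_pair]
    have := hnx _ _ (ZFSet.pair a b) (hC' a) (hC' b)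
    exact ⟨this.1, this.2.1⟩

theorem IsClubIn.exists_closed_imp_mem {A C : ZFSet.{u}} (hC : IsClubIn A ℵ₁ C)
    (hne : (subsetsOfCard A ℵ₁).Nonempty) (hA : ∀ a ∈ A, ∀ b ∈ A, ZFSet.pair a b ∈ A) :
    ∃ F : ZFSet.{u} → ZFSet.{u} → ZFSet.{u}, (∀ s t, F s t ⊆ A ∧ (F s t).card ≤ ℵ₁) ∧
      ∀ N, N ⊆ A → N.Nonempty → N.card ≤ ℵ₁ → (∀ s ∈ N, ∀ t ∈ N, F s t ⊆ N) → N ∈ C := by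
  obtain ⟨g, hg, hself, hpair⟩ := exists_pair_hull hC hne
  have hgA : ∀ z, g z ⊆ A ∧ (g z).card = ℵ₁ := fun z => mem_subsetsOfCard.1 (hC.subset (hg z))
  refine ⟨fun s t => g (ZFSet.pair s t), fun s t => ⟨(hgA _).1, (hgA _).2.le⟩,
    fun N hNA hN hc hcl => ?_⟩
  obtain ⟨x₀, hx₀⟩ := hN
  have hcl' : ∀ s ∈ N, ∀ t ∈ N, ZFSet.pair s t ∈ N := fun s hs t ht =>
    hcl s hs t ht (hself _ (hA s (hNA hs) t (hNA ht)))
  have e : N = ZFSet.iUnion fun p : N × N => g (ZFSet.pair p.1 p.2) := by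
    ext z
    rw [ZFSet.mem_iUnion]
    refine ⟨fun hz => ⟨(⟨z, hz⟩, ⟨z, hz⟩), ?_⟩, fun ⟨p, hp⟩ => hcl _ p.1.2 _ p.2.2 hp⟩
    exact (hpair z z).1 (hself z (hNA hz))
  rw [e]
  have : Nonempty (N × N) := ⟨(⟨x₀, hx₀⟩, ⟨x₀, hx₀⟩)⟩
  refine hC.iUnion_mem_of_directed ?_ (fun p => hg _) fun p q =>
    ⟨(⟨_, hcl' _ p.1.2 _ p.2.2⟩, ⟨_, hcl' _ q.1.2 _ q.2.2⟩), hpair _ _⟩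
  rw [Cardinal.mk_prod, Cardinal.lift_id, ZFSet.cardinalMk_coe_sort, ← Cardinal.lift_mul,
    Cardinal.lift_le]
  exact (mul_le_mul' hc hc).trans (mul_eq_self (aleph0_le_aleph 1)).le

theorem union_mem_subsetsOfCard {A x y : ZFSet.{u}} (hx : x ∈ subsetsOfCard A ℵ₀) (hy : y ⊆ A)
    (hc : y.card ≤ ℵ₀) : x ∪ y ∈ subsetsOfCard A ℵ₀ := by
  obtain ⟨h₁, h₂⟩ := mem_subsetsOfCard.1 hx
  refine mem_subsetsOfCard.2 ⟨fun z hz => (ZFSet.mem_union.1 hz).elim (@h₁ z) (@hy z),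
    le_antisymm ?_ ?_⟩
  · exact ZFSet.card_union_le.trans (add_le_of_le le_rfl h₂.le hc)
  · exact h₂.symm.le.trans (ZFSet.card_mono fun z hz => ZFSet.mem_union.2 (Or.inl hz))

theorem nonempty_of_mem_subsetsOfCard {A x : ZFSet.{u}} (hx : x ∈ subsetsOfCard A ℵ₀) :
    x.Nonempty := by
  rcases ZFSet.eq_empty_or_nonempty x with rfl | h
  · have := (mem_subsetsOfCard.1 hx).2
    rw [ZFSet.card_empty] at this
    exact absurd this.symm aleph0_ne_zero
  · exact h

theorem IsStationaryIn.exists_superset {A S B : ZFSet.{u}} (hS : IsStationaryIn A ℵ₀ S)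
    (hB : B ⊆ A) (hc : B.card ≤ ℵ₀) : ∃ N ∈ S, B ⊆ N := by
  obtain ⟨N, hN, h⟩ := hS.exists_closed (F := fun _ _ => B) fun _ _ => ⟨hB, hc⟩
  obtain ⟨y, hy⟩ := nonempty_of_mem_subsetsOfCard (hS.1 hN)
  exact ⟨N, hN, h y hy y hy⟩

/-- `⟨Q α | δ < α ≤ γ⟩` is a continuous `∈`-chain above `x` with `Q α ∈ R α`, whose last member
contains all the others. -/
structure IsTail (R : Ordinal.{u} → ZFSet.{u}) (x : ZFSet.{u}) (δ γ : Ordinal.{u})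
    (Q : Ordinal.{u} → ZFSet.{u}) : Prop where
  mem : ∀ α, δ < α → α ≤ γ → Q α ∈ R α
  base : ∀ α, δ < α → α ≤ γ → x ⊆ Q α
  step : ∀ α, δ < α → α + 1 ≤ γ → Q α ∈ Q (α + 1)
  top : ∀ α, δ < α → α ≤ γ → Q α ⊆ Q γ
  cont : ∀ l, δ < l → l ≤ γ → IsSuccLimit l → ∀ y, y ∈ Q l ↔ ∃ i, δ < i ∧ i < l ∧ y ∈ Q i

theorem exists_cofinal_seq {δ γ : Ordinal.{u}} (hγ : γ < ω₁) (hl : IsSuccLimit γ) (hδ : δ < γ) :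
    ∃ g : ℕ → Ordinal.{u}, g 0 = δ ∧ StrictMono g ∧ (∀ n, g n < γ) ∧
      ∀ α < γ, ∃ n, α ≤ g n := by
  have : Countable (Set.Iio γ) := (countable_Iio hγ).to_subtype
  have : Nonempty (Set.Iio γ) := ⟨⟨δ, hδ⟩⟩
  obtain ⟨e, he⟩ := exists_surjective_nat (Set.Iio γ)
  let g : ℕ → Set.Iio γ := fun n =>
    Nat.rec ⟨δ, hδ⟩ (fun n p => ⟨max p.1 (e n).1 + 1, hl.add_one_lt (max_lt p.2 (e n).2)⟩) n
  have hs : ∀ n, (g (n + 1)).1 = max (g n).1 (e n).1 + 1 := fun n => rfl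
  refine ⟨fun n => (g n).1, rfl, strictMono_nat_of_lt_succ fun n => ?_, fun n => (g n).2,
    fun α hα => ?_⟩
  · rw [hs]
    exact lt_add_one_iff.2 (le_max_left _ _)
  · obtain ⟨n, hn⟩ := he ⟨α, hα⟩
    refine ⟨n + 1, ?_⟩
    change α ≤ (g (n + 1)).1
    rw [hs, hn]
    exact (le_max_right _ _).trans (le_succ _)

theorem exists_between_seq {γ α : Ordinal.{u}} {g : ℕ → Ordinal.{u}}
    (hcof : ∀ α < γ, ∃ n, α ≤ g n) (h₁ : g 0 < α) (h₂ : α < γ) :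
    ∃ n, g n < α ∧ α ≤ g (n + 1) := by
  classical
  have hex := hcof α h₂
  obtain ⟨n, hn⟩ : ∃ n, Nat.find hex = n + 1 := Nat.exists_eq_succ_of_ne_zero fun h0 => by
    have := Nat.find_spec hex
    rw [h0] at this
    exact this.not_gt h₁
  refine ⟨n, not_le.1 (Nat.find_min hex (by omega)), ?_⟩
  rw [← hn]
  exact Nat.find_spec hex

theorem exists_isTail_limit {κ : Cardinal.{u}} (hκ : κ.IsRegular) (h₀ : ℵ₀ < κ)
    {R : Ordinal.{u} → ZFSet.{u}} (hR : ∀ α, IsStationaryIn (H κ) ℵ₀ (R α)) {δ γ : Ordinal.{u}}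
    (hγ : γ < ω₁) (hl : IsSuccLimit γ) (hδ : δ < γ)
    (ih : ∀ β < γ, ∀ δ < β, ∀ x ∈ subsetsOfCard (H κ) ℵ₀, ∃ Q, IsTail R x δ β Q)
    {x : ZFSet.{u}} (hx : x ∈ subsetsOfCard (H κ) ℵ₀) : ∃ Q, IsTail R x δ γ Q := by
  classical
  obtain ⟨g, rfl, hg, hgγ, hcof⟩ := exists_cofinal_seq hγ hl hδ
  have hsub := subsetsOfCard_subset_H hκ h₀
  choose! G hG using fun n => ih (g (n + 1)) (hgγ _) (g n) (hg n.lt_succ_self)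
  have hGH : ∀ n z α, z ∈ subsetsOfCard (H κ) ℵ₀ → g n < α → α ≤ g (n + 1) →
      G n z α ∈ subsetsOfCard (H κ) ℵ₀ := fun n z α hz h₁ h₂ =>
    (hR α).1 ((hG n z hz).mem α h₁ h₂)
  have hz : ∀ y a, y ∈ subsetsOfCard (H κ) ℵ₀ → a ∈ H κ →
      y ∪ {y, a} ∈ subsetsOfCard (H κ) ℵ₀ := fun y a hy ha => by
    refine union_mem_subsetsOfCard hy (fun t ht => ?_) card_pair_le
    rcases ZFSet.mem_pair.1 ht with rfl | rfl
    exacts [hsub hy, ha]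
  let F : ZFSet.{u} → ZFSet.{u} → ZFSet.{u} := fun y a => (x ∪ {x, x}) ∪
    if y ∈ subsetsOfCard (H κ) ℵ₀ ∧ a ∈ H κ then
      y ∪ ZFSet.range fun n : ℕ => G n (y ∪ {y, a}) (g (n + 1)) else ∅
  have hF : ∀ y a, F y a ∈ subsetsOfCard (H κ) ℵ₀ := by
    intro y a
    refine union_mem_subsetsOfCard (hz x x hx (hsub hx)) ?_ ?_ <;> split_ifs with h
    · intro t ht
      rcases ZFSet.mem_union.1 ht with ht | ht
      · exact (mem_subsetsOfCard.1 h.1).1 ht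
      · obtain ⟨n, rfl⟩ := ZFSet.mem_range.1 ht
        exact hsub (hGH _ _ _ (hz y a h.1 h.2) (hg n.lt_succ_self) le_rfl)
    · exact ZFSet.empty_subset _
    · exact ZFSet.card_union_le.trans (add_le_of_le le_rfl (mem_subsetsOfCard.1 h.1).2.le
        (card_range_le (by simp)))
    · simp
  obtain ⟨N, hN, hNF⟩ := (hR γ).exists_closed fun y a =>
    ⟨(mem_subsetsOfCard.1 (hF y a)).1, (mem_subsetsOfCard.1 (hF y a)).2.le⟩
  have hNH := mem_subsetsOfCard.1 ((hR γ).1 hN)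
  have hxN : x ∈ N := by
    obtain ⟨y, hy⟩ := nonempty_of_mem_subsetsOfCard ((hR γ).1 hN)
    exact hNF y hy y hy (by simp [F])
  obtain ⟨a, ha⟩ := (card_le_aleph0_iff.1 hNH.2.le).exists_eq_range ⟨x, hxN⟩
  have haN : ∀ n, a n ∈ N := fun n => by
    have : a n ∈ (N : Set ZFSet.{u}) := ha ▸ ⟨n, rfl⟩
    exact this
  let y : ℕ → ZFSet.{u} := fun n => Nat.rec x (fun n y => G n (y ∪ {y, a n}) (g (n + 1))) n
  let z : ℕ → ZFSet.{u} := fun n => y n ∪ {y n, a n}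
  have hy_succ : ∀ n, y (n + 1) = G n (z n) (g (n + 1)) := fun n => rfl
  have hyN : ∀ n, y n ∈ N ∧ y n ∈ subsetsOfCard (H κ) ℵ₀ := by
    intro n
    induction n with
    | zero => exact ⟨hxN, hx⟩
    | succ n ih =>
      have haH := hNH.1 (haN n)
      refine ⟨hNF _ ih.1 _ (haN n) ?_, hGH _ _ _ (hz _ _ ih.2 haH) (hg n.lt_succ_self) le_rfl⟩
      refine ZFSet.mem_union.2 (Or.inr ?_)
      rw [if_pos ⟨ih.2, haH⟩]
      exact ZFSet.mem_union.2 (Or.inr (ZFSet.mem_range.2 ⟨n, rfl⟩))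
  have hyN' : ∀ n, y n ⊆ N := fun n t ht => hNF _ (hyN n).1 _ hxN (by
    refine ZFSet.mem_union.2 (Or.inr ?_)
    rw [if_pos ⟨(hyN n).2, hNH.1 hxN⟩]
    exact ZFSet.mem_union.2 (Or.inl ht))
  have hzs : ∀ n, z n ∈ subsetsOfCard (H κ) ℵ₀ := fun n => hz _ _ (hyN n).2 (hNH.1 (haN n))
  have hT : ∀ n, IsTail R (z n) (g n) (g (n + 1)) (G n (z n)) := fun n => hG n _ (hzs n)
  have hyz : ∀ n, y n ⊆ z n := fun n t ht => ZFSet.mem_union.2 (Or.inl ht)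
  have hzy : ∀ n, z n ⊆ y (n + 1) := fun n => (hT n).base _ (hg n.lt_succ_self) le_rfl
  have hymono : ∀ m n, m ≤ n → y m ⊆ y n := fun m n h =>
    monotone_nat_of_le_succ (f := y) (fun n => (hyz n).trans (hzy n)) h
  let Q : Ordinal.{u} → ZFSet.{u} := fun α =>
    if h : ∃ n, g n < α ∧ α ≤ g (n + 1) then G h.choose (z h.choose) α else N
  have huniq : ∀ m n α, g m < α → α ≤ g (m + 1) → g n < α → α ≤ g (n + 1) → m = n := by
    intro m n α h₁ h₂ h₃ h₄
    have := hg.lt_iff_lt.1 (h₁.trans_le h₄)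
    have := hg.lt_iff_lt.1 (h₃.trans_le h₂)
    omega
  have hQ : ∀ n α, g n < α → α ≤ g (n + 1) → Q α = G n (z n) α := by
    intro n α h₁ h₂
    have h : ∃ n, g n < α ∧ α ≤ g (n + 1) := ⟨n, h₁, h₂⟩
    have e := huniq _ n α h.choose_spec.1 h.choose_spec.2 h₁ h₂
    simp only [Q]
    rw [dif_pos h, e]
  have hQγ : Q γ = N := dif_neg fun ⟨n, hn⟩ => (hgγ _).not_ge hn.2
  have hQy : ∀ n, Q (g (n + 1)) = y (n + 1) := fun n => hQ n _ (hg n.lt_succ_self) le_rfl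
  have hQsub : ∀ n α, g n < α → α ≤ g (n + 1) → Q α ⊆ y (n + 1) := fun n α h₁ h₂ => by
    rw [hQ n α h₁ h₂]
    exact (hT n).top α h₁ h₂
  have hlt : ∀ α, g 0 < α → α < γ → ∃ n, g n < α ∧ α ≤ g (n + 1) := fun α =>
    exists_between_seq hcof
  have hg0 : ∀ n, g 0 ≤ g n := fun n => hg.monotone n.zero_le
  refine ⟨Q, ⟨fun α h₁ h₂ => ?_, fun α h₁ h₂ => ?_, fun α h₁ h₂ => ?_, fun α h₁ h₂ => ?_,
    fun l h₁ h₂ hl' t => ?_⟩⟩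
  · rcases h₂.eq_or_lt with rfl | h₂
    · rwa [hQγ]
    · obtain ⟨n, hn, hn'⟩ := hlt α h₁ h₂
      rw [hQ n α hn hn']
      exact (hT n).mem α hn hn'
  · rcases h₂.eq_or_lt with rfl | h₂
    · rw [hQγ]
      exact hyN' 0
    · obtain ⟨n, hn, hn'⟩ := hlt α h₁ h₂
      rw [hQ n α hn hn']
      exact (hymono 0 n n.zero_le).trans ((hyz n).trans ((hT n).base α hn hn'))
  · have h₃ : α + 1 < γ := h₂.lt_of_ne fun e => by
      rw [← e] at hl
      exact not_isSuccLimit_add_one α hl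
    have hα : α < α + 1 := lt_add_one_iff.2 le_rfl
    obtain ⟨n, hn, hn'⟩ := hlt α h₁ (hα.trans h₃)
    rcases hn'.eq_or_lt with rfl | h
    · have h' : g (n + 1) + 1 ≤ g (n + 1 + 1) := add_one_le_of_lt (hg (n + 1).lt_succ_self)
      rw [hQy, hQ (n + 1) _ hα h']
      exact (hT (n + 1)).base _ hα h' (ZFSet.mem_union.2 (Or.inr (ZFSet.mem_pair.2 (Or.inl rfl))))
    · have h' : α + 1 ≤ g (n + 1) := add_one_le_of_lt h
      rw [hQ n α hn hn', hQ n _ (hn.trans hα) h']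
      exact (hT n).step α hn h'
  · rw [hQγ]
    rcases h₂.eq_or_lt with rfl | h₂
    · rw [hQγ]
    · obtain ⟨n, hn, hn'⟩ := hlt α h₁ h₂
      exact (hQsub n α hn hn').trans (hyN' (n + 1))
  · rcases h₂.eq_or_lt with rfl | h₂
    · rw [hQγ]
      constructor
      · intro ht
        obtain ⟨n, rfl⟩ : t ∈ Set.range a := ha ▸ ht
        refine ⟨g (n + 1), hg n.succ_pos, hgγ _, ?_⟩
        rw [hQy]
        exact hzy n (ZFSet.mem_union.2 (Or.inr (ZFSet.mem_pair.2 (Or.inr rfl))))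
      · rintro ⟨i, hi, hil, ht⟩
        obtain ⟨n, hn, hn'⟩ := hlt i hi hil
        exact hyN' (n + 1) (hQsub n i hn hn' ht)
    · obtain ⟨n, hn, hn'⟩ := hlt l h₁ h₂
      rw [hQ n l hn hn']
      constructor
      · intro ht
        obtain ⟨i, hi, hil, ht⟩ := ((hT n).cont l hn hn' hl' t).1 ht
        exact ⟨i, (hg0 n).trans_lt hi, hil, by rwa [hQ n i hi (hil.le.trans hn')]⟩
      · rintro ⟨i, hi, hil, ht⟩
        rcases lt_or_ge (g n) i with h | h
        · exact ((hT n).cont l hn hn' hl' t).2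
            ⟨i, h, hil, by rwa [hQ n i h (hil.le.trans hn')] at ht⟩
        · obtain ⟨m, hm, hm'⟩ := hlt i hi (hil.trans h₂)
          have hmn : m < n := hg.lt_iff_lt.1 (hm.trans_le h)
          exact (hT n).base l hn hn' (hyz n (hymono (m + 1) n hmn (hQsub m i hm hm' ht)))

theorem exists_isTail {κ : Cardinal.{u}} (hκ : κ.IsRegular) (h₀ : ℵ₀ < κ)
    {R : Ordinal.{u} → ZFSet.{u}} (hR : ∀ α, IsStationaryIn (H κ) ℵ₀ (R α)) (γ : Ordinal.{u}) :
    γ < ω₁ → ∀ δ < γ, ∀ x ∈ subsetsOfCard (H κ) ℵ₀, ∃ Q, IsTail R x δ γ Q := by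
  classical
  induction γ using WellFoundedLT.induction with
  | _ γ ih =>
    intro hγ δ hδ x hx
    rcases Ordinal.zero_or_succ_or_isSuccLimit γ with rfl | ⟨β, rfl⟩ | hl
    · exact absurd hδ not_lt_zero
    · have hβ : β < succ β := lt_succ β
      have hR' := (hR (succ β)).1
      have hxH := mem_subsetsOfCard.1 hx
      have hsucc : ∀ l, l ≤ succ β → IsSuccLimit l → l ≤ β := fun l h h' =>
        lt_succ_iff.1 (h.lt_of_ne fun e => not_isSuccLimit_succ β (e ▸ h'))
      rcases (lt_succ_iff.1 hδ).eq_or_lt with rfl | hδβ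
      · obtain ⟨N, hN, hxN⟩ := (hR (succ δ)).exists_superset hxH.1 hxH.2.le
        have hα : ∀ α, δ < α → α ≤ succ δ → α = succ δ := fun α h h' =>
          le_antisymm h' (succ_le_of_lt h)
        exact ⟨fun _ => N, ⟨fun α h h' => hα α h h' ▸ hN, fun _ _ _ => hxN,
          fun α h h' => absurd h (not_lt.2 (succ_le_succ_iff.1 h')), fun _ _ _ _ h => h,
          fun l h h' h'' => absurd h (not_lt.2 (hsucc l h' h''))⟩⟩
      · obtain ⟨Q, hQ⟩ := ih β hβ (hβ.trans hγ) δ hδβ x hx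
        have hQβ := (hR β).1 (hQ.mem β hδβ le_rfl)
        have hmem : Q β ∪ {Q β, Q β} ∈ subsetsOfCard (H κ) ℵ₀ := by
          refine union_mem_subsetsOfCard hQβ (fun t ht => ?_) card_pair_le
          rw [ZFSet.mem_pair, or_self] at ht
          exact ht ▸ subsetsOfCard_subset_H hκ h₀ hQβ
        obtain ⟨N, hN, hsubN⟩ := (hR (succ β)).exists_superset (mem_subsetsOfCard.1 hmem).1
          (mem_subsetsOfCard.1 hmem).2.le
        have hQN : Q β ⊆ N := fun t ht => hsubN (ZFSet.mem_union.2 (Or.inl ht))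
        have hQN' : Q β ∈ N := hsubN (ZFSet.mem_union.2 (Or.inr (ZFSet.mem_pair.2 (Or.inl rfl))))
        let Q' := fun α => if α ≤ β then Q α else N
        have h₁ : ∀ α, α ≤ β → Q' α = Q α := fun α h => if_pos h
        have h₂ : Q' (succ β) = N := if_neg hβ.not_ge
        have hcases : ∀ α, α ≤ succ β → α ≤ β ∨ α = succ β := fun α h =>
          (h.lt_or_eq).imp_left lt_succ_iff.1
        refine ⟨Q', ⟨fun α h h' => ?_, fun α h h' => ?_, fun α h h' => ?_, fun α h h' => ?_,
          fun l h h' hl t => ?_⟩⟩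
        · rcases hcases α h' with h' | rfl
          · rw [h₁ α h']
            exact hQ.mem α h h'
          · rwa [h₂]
        · rcases hcases α h' with h' | rfl
          · rw [h₁ α h']
            exact hQ.base α h h'
          · rw [h₂]
            exact (hQ.base β hδβ le_rfl).trans hQN
        · rcases hcases _ h' with h' | h'
          · rw [h₁ _ h', h₁ α ((le_succ α).trans h')]
            exact hQ.step α h h'
          · obtain rfl : α = β := succ_injective h'
            rw [h', h₂, h₁ α le_rfl]
            exact hQN'
        · rcases hcases α h' with h' | rfl
          · rw [h₁ α h', h₂]
            exact (hQ.top α h h').trans hQN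
          · exact fun _ h => h
        · have hlβ := hsucc l h' hl
          rw [h₁ l hlβ, hQ.cont l h hlβ hl t]
          refine exists_congr fun i => and_congr_right fun _ => and_congr_right fun hi => ?_
          rw [h₁ i (hi.le.trans hlβ)]
    · exact exists_isTail_limit hκ h₀ hR hγ hl hδ (fun β hβ => ih β hβ (hβ.trans hγ)) hx

/-! ### Extending conditions -/

theorem IsConditionData.exists_extension {κ : Cardinal.{u}} (hκ : κ.IsRegular) (h₀ : ℵ₀ < κ)
    {𝒮 : ZFSet.{u}} {T : CtblOrd.{u} → Set CtblOrd.{u}} (h𝒮 : IsStationaryFamily κ 𝒮)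
    (hT : IsDisjointStationarySeq T) {δ l : Ordinal.{u}} {Q S : Ordinal.{u} → ZFSet.{u}}
    (hp : IsConditionData κ 𝒮 T δ l Q S) {γ : Ordinal.{u}} (hγ : γ < ω₁) {a : ZFSet.{u}}
    (ha : a ∈ H κ) {s : ZFSet.{u}} (hs : s ∈ 𝒮) :
    ∃ δ' l' Q' S', IsConditionData κ 𝒮 T δ' l' Q' S' ∧ δ ≤ δ' ∧ l < l' ∧
      (∀ α ≤ δ, Q' α = Q α) ∧ (∀ i < l, S' i = S i) ∧ γ ≤ δ' ∧ γ ≤ l' ∧ a ∈ Q' δ' ∧ S' l = s := by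
  classical
  have hω : ∀ α < ω₁, α + 1 < (ω₁ : Ordinal.{u}) := fun α => (isSuccLimit_omega 1).add_one_lt
  set δ' := max γ (δ + 1)
  have hδ'ω : δ' < ω₁ := max_lt hγ (hω δ hp.lt₁)
  have hδδ' : δ < δ' := lt_max_of_lt_right (lt_add_one_iff.2 le_rfl)
  let S' : Ordinal.{u} → ZFSet.{u} := fun i => if i < l then S i else s
  have hS' : ∀ i, S' i ∈ 𝒮 := fun i => by
    simp only [S']
    split_ifs with h
    exacts [hp.mem_family i h, hs]
  let idx : Ordinal.{u} → Ordinal.{u} := fun α =>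
    if h : ∃ i : CtblOrd.{u}, ∃ hα : α < ω₁, (⟨α, hα⟩ : CtblOrd.{u}) ∈ T i then h.choose.1 else l
  have hidx : ∀ α i : CtblOrd.{u}, α ∈ T i → idx α.1 = i.1 := by
    intro α i h
    have hex : ∃ i : CtblOrd.{u}, ∃ hα : α.1 < ω₁, (⟨α.1, hα⟩ : CtblOrd.{u}) ∈ T i :=
      ⟨i, α.2, h⟩
    have e : hex.choose = i := by
      by_contra hne
      obtain ⟨h₁, h₂⟩ := hex.choose_spec
      exact Set.disjoint_left.1 (hT.2 _ _ hne) h₂ h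
    simp only [idx]
    rw [dif_pos hex, e]
  have hidxω : ∀ α, idx α < ω₁ := fun α => by
    simp only [idx]
    split_ifs with h
    exacts [h.choose.2, hp.lt₂]
  obtain ⟨x, hx, hxQ, hδx, hax⟩ : ∃ x ∈ subsetsOfCard (H κ) ℵ₀,
      (∀ i ≤ δ, Q i ⊆ x) ∧ Q δ ∈ x ∧ a ∈ x := by
    refine ⟨Q δ ∪ ((ZFSet.iUnion fun i : Set.Iio (δ + 1) => Q i) ∪ {Q δ, a}),
      union_mem_subsetsOfCard (hp.mem δ le_rfl) (fun t ht => ?_) ?_, fun i hi t ht => ?_, ?_, ?_⟩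
    · rcases ZFSet.mem_union.1 ht with ht | ht
      · obtain ⟨i, hi⟩ := ZFSet.mem_iUnion.1 ht
        exact (mem_subsetsOfCard.1 (hp.mem i (lt_add_one_iff.1 i.2))).1 hi
      · rcases ZFSet.mem_pair.1 ht with rfl | rfl
        exacts [subsetsOfCard_subset_H hκ h₀ (hp.mem δ le_rfl), ha]
    · refine ZFSet.card_union_le.trans (add_le_of_le le_rfl (card_iUnion_le le_rfl ?_ fun i =>
        (mem_subsetsOfCard.1 (hp.mem i (lt_add_one_iff.1 i.2))).2.le) card_pair_le)
      rw [Cardinal.mk_Iio_ordinal, Cardinal.lift_lift, Cardinal.lift_le]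
      exact card_lt_aleph_one (hω δ hp.lt₁)
    · exact ZFSet.mem_union.2 (Or.inr (ZFSet.mem_union.2 (Or.inl
        (ZFSet.mem_iUnion.2 ⟨⟨i, lt_add_one_iff.2 hi⟩, ht⟩))))
    · simp
    · simp
  obtain ⟨Q₁, hQ₁⟩ := exists_isTail hκ h₀ (R := fun α => S' (idx α))
    (fun α => h𝒮 _ (hS' _)) δ' hδ'ω δ hδδ' x hx
  let Q' : Ordinal.{u} → ZFSet.{u} := fun α => if α ≤ δ then Q α else Q₁ α
  have hle : ∀ α ≤ δ, Q' α = Q α := fun α h => if_pos h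
  have hgt : ∀ α, δ < α → Q' α = Q₁ α := fun α h => if_neg h.not_ge
  have : Countable (Set.Iio (δ' + 1)) := (countable_Iio (hω δ' hδ'ω)).to_subtype
  set l' := max (max γ (l + 1)) (⨆ α : Set.Iio (δ' + 1), (idx α + 1))
  have hll' : l < l' := lt_max_of_lt_left (lt_max_of_lt_right (lt_add_one_iff.2 le_rfl))
  refine ⟨δ', l', Q', S', ⟨hδ'ω, ?_, fun α hα => ?_, ⟨fun i hi => ?_, fun m hm hlim t => ?_⟩,
    fun i _ => hS' i, fun α i hα hi => ?_⟩, hδδ'.le, hll', hle, fun i hi => if_pos hi,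
    le_max_left _ _, (le_max_left _ _).trans (le_max_left _ _), ?_, if_neg (lt_irrefl l)⟩
  · exact max_lt (max_lt hγ (hω l hp.lt₂))
      (Ordinal.iSup_lt_omega_one fun α => hω _ (hidxω α))
  · rcases le_or_gt α δ with h | h
    · rw [hle α h]
      exact hp.mem α h
    · rw [hgt α h]
      exact (h𝒮 _ (hS' _)).1 (hQ₁.mem α h hα)
  · have hi' : i + 1 ≤ δ' := lt_add_one_iff.1 hi
    have hii : i < i + 1 := lt_add_one_iff.2 le_rfl
    rcases lt_trichotomy i δ with h | rfl | h
    · have h' := add_one_le_of_lt h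
      rw [hle i h.le, hle _ h']
      exact hp.chain.1 i (lt_add_one_iff.2 h')
    · rw [hle i le_rfl, hgt _ hii]
      exact hQ₁.base _ hii hi' hδx
    · rw [hgt i h, hgt _ (h.trans hii)]
      exact hQ₁.step i h hi'
  · have hm' : m ≤ δ' := lt_add_one_iff.1 hm
    rcases le_or_gt m δ with h | h
    · rw [hle m h, hp.chain.2 m (lt_add_one_iff.2 h) hlim t]
      refine exists_congr fun i => and_congr_right fun hi => ?_
      rw [hle i (hi.le.trans h)]
    · rw [hgt m h, hQ₁.cont m h hm' hlim t]
      constructor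
      · rintro ⟨i, hi, him, ht⟩
        exact ⟨i, him, by rwa [hgt i hi]⟩
      · rintro ⟨i, him, ht⟩
        rcases le_or_gt i δ with h' | h'
        · rw [hle i h'] at ht
          exact (hQ₁.cont m h hm' hlim t).1 (hQ₁.base m h hm' (hxQ i h' ht))
        · exact ⟨i, h', him, by rwa [hgt i h'] at ht⟩
  · rcases le_or_gt α.1 δ with h | h
    · obtain ⟨h₁, h₂⟩ := hp.diagonal α i h hi
      refine ⟨h₁.trans hll', ?_⟩
      rw [hle _ h]
      simpa only [S', if_pos h₁] using h₂
    · refine ⟨?_, ?_⟩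
      · refine lt_of_lt_of_le ?_ (le_max_right _ _)
        rw [← hidx α i hi]
        exact (lt_add_one_iff.2 le_rfl).trans_le
          (Ordinal.le_iSup (fun α : Set.Iio (δ' + 1) => idx α + 1) ⟨α.1, lt_add_one_iff.2 hα⟩)
      · rw [hgt _ h, ← hidx α i hi]
        exact hQ₁.mem _ h hα
  · rw [hgt _ hδδ']
    exact hQ₁.base _ hδδ' le_rfl hax

theorem exists_conditionData {κ : Cardinal.{u}} {𝒮 : ZFSet.{u}}
    {T : CtblOrd.{u} → Set CtblOrd.{u}} (hne : 𝒮.Nonempty) (h𝒮 : IsStationaryFamily κ 𝒮)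
    (hT : IsDisjointStationarySeq T) : ∃ δ l Q S, IsConditionData κ 𝒮 T δ l Q S := by
  classical
  obtain ⟨s, hs⟩ := hne
  obtain ⟨N, hN, -⟩ := (h𝒮 s hs).exists_superset (ZFSet.empty_subset _)
    (by rw [ZFSet.card_empty]; exact zero_le)
  obtain ⟨l, hl, hl'⟩ : ∃ l < ω₁, ∀ α i : CtblOrd.{u}, α.1 ≤ 0 → α ∈ T i → i.1 < l := by
    by_cases h : ∃ i, (⟨0, omega_pos 1⟩ : CtblOrd.{u}) ∈ T i
    · obtain ⟨i, hi⟩ := h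
      refine ⟨i.1 + 1, (isSuccLimit_omega 1).add_one_lt i.2, fun α j hα hj => ?_⟩
      obtain rfl : α = ⟨0, omega_pos 1⟩ := Subtype.ext (le_zero_iff.1 hα)
      have e : i = j := by
        by_contra hne
        exact Set.disjoint_left.1 (hT.2 _ _ hne) hi hj
      exact lt_add_one_iff.2 (e ▸ le_rfl)
    · refine ⟨0, omega_pos 1, fun α j hα hj => absurd ⟨j, ?_⟩ h⟩
      obtain rfl : α = ⟨0, omega_pos 1⟩ := Subtype.ext (le_zero_iff.1 hα)
      exact hj
  refine ⟨0, l, fun _ => N, fun _ => s, omega_pos 1, hl, fun _ _ => (h𝒮 s hs).1 hN,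
    ⟨fun i hi => ?_, fun m hm hlim => ?_⟩, fun _ _ => hs, fun α i hα hi => ⟨hl' α i hα hi, hN⟩⟩
  · exact absurd (lt_add_one_iff.1 hi) (not_le.2 (lt_of_le_of_lt zero_le
      (lt_add_one_iff.2 (le_refl i))))
  · exact absurd (le_zero_iff.1 (lt_add_one_iff.1 hm)) hlim.ne_bot

theorem dsrpForcing_le_iff {κ : Cardinal.{u}} {𝒮 : ZFSet.{u}} {T : CtblOrd.{u} → Set CtblOrd.{u}}
    {p q : (dsrpForcing κ 𝒮 T).carrier} {δ l δ' l' : Ordinal.{u}}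
    {Q S Q' S' : Ordinal.{u} → ZFSet.{u}} (hp : p.1 = condition δ l Q S)
    (hq : q.1 = condition δ' l' Q' S') :
    (dsrpForcing κ 𝒮 T).le q p ↔ (∀ i < δ + 1, i < δ' + 1 ∧ Q i = Q' i) ∧
      ∀ i < l, i < l' ∧ S i = S' i := by
  rw [← seq_subset_seq_iff, ← seq_subset_seq_iff]
  constructor
  · rintro ⟨a, b, a', b', h₁, h₂, h₃, h₄⟩
    obtain ⟨rfl, rfl⟩ := ZFSet.pair_inj.1 (hp.symm.trans h₂)
    obtain ⟨rfl, rfl⟩ := ZFSet.pair_inj.1 (hq.symm.trans h₁)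
    exact ⟨h₃, h₄⟩
  · exact fun h => ⟨_, _, _, _, hq, hp, h.1, h.2⟩

theorem exists_extension {κ : Cardinal.{u}} (hκ : κ.IsRegular) (h₀ : ℵ₀ < κ)
    {𝒮 : ZFSet.{u}} {T : CtblOrd.{u} → Set CtblOrd.{u}} (h𝒮 : IsStationaryFamily κ 𝒮)
    (hT : IsDisjointStationarySeq T) (p : (dsrpForcing κ 𝒮 T).carrier) {γ : Ordinal.{u}}
    (hγ : γ < ω₁) {a : ZFSet.{u}} (ha : a ∈ H κ) {s : ZFSet.{u}} (hs : s ∈ 𝒮) :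
    ∃ (q : (dsrpForcing κ 𝒮 T).carrier) (δ l : Ordinal.{u}) (Q S : Ordinal.{u} → ZFSet.{u}),
      (dsrpForcing κ 𝒮 T).le q p ∧ IsConditionData κ 𝒮 T δ l Q S ∧ q.1 = condition δ l Q S ∧
      γ ≤ δ ∧ γ ≤ l ∧ (∃ α ≤ δ, a ∈ Q α) ∧ ∃ i < l, S i = s := by
  obtain ⟨δ, l, Q, S, hp, hpc⟩ := mem_conditions.1 p.2
  obtain ⟨δ', l', Q', S', hq, h₁, h₂, h₃, h₄, h₅, h₆, h₇, h₈⟩ :=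
    hp.exists_extension hκ h₀ h𝒮 hT hγ ha hs
  refine ⟨⟨_, mem_conditions.2 ⟨δ', l', Q', S', hq, rfl⟩⟩, δ', l', Q', S',
    (dsrpForcing_le_iff hpc rfl).2 ⟨fun i hi => ?_, fun i hi => ⟨hi.trans h₂, (h₄ i hi).symm⟩⟩,
    hq, rfl, h₅, h₆, ⟨δ', le_rfl, h₇⟩, l, h₂, h₈⟩
  have hi' := lt_add_one_iff.1 hi
  exact ⟨lt_add_one_iff.2 (hi'.trans h₁), (h₃ i hi').symm⟩

/-! ### The size of `H_κ` -/

theorem symm_apply_eq_of_mem_iff {ι : Type*} {y y' : ZFSet.{u}} (hy : y.IsTransitive)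
    (hy' : y'.IsTransitive) (e : y ≃ ι) (e' : y' ≃ ι)
    (h : ∀ i j, (e.symm i).1 ∈ (e.symm j).1 ↔ (e'.symm i).1 ∈ (e'.symm j).1) (i : ι) :
    (e.symm i).1 = (e'.symm i).1 := by
  have key : ∀ z i, (e.symm i).1 = z → (e.symm i).1 = (e'.symm i).1 := by
    intro z
    induction z using ZFSet.inductionOn with
    | _ z ih =>
      rintro i rfl
      ext w
      constructor
      · intro hw
        have hwy : w ∈ y := hy.subset_of_mem (e.symm i).2 hw
        have e₁ : (e.symm (e ⟨w, hwy⟩)).1 = w := by rw [Equiv.symm_apply_apply]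
        have e₂ := ih w hw _ e₁
        rw [← e₁, e₂, ← h, e₁]
        exact hw
      · intro hw
        have hwy : w ∈ y' := hy'.subset_of_mem (e'.symm i).2 hw
        have e₁ : (e'.symm (e' ⟨w, hwy⟩)).1 = w := by rw [Equiv.symm_apply_apply]
        have hm : (e.symm (e' ⟨w, hwy⟩)).1 ∈ (e.symm i).1 := by rwa [h, e₁]
        rwa [ih _ hm _ rfl, e₁] at hm
  exact key _ i rfl

/-- The members of transitive sets that can be enumerated by `α`. -/
def enumerable (α : Ordinal.{u}) : Set ZFSet.{u} :=
  {x | ∃ y : ZFSet.{u}, y.IsTransitive ∧ x ∈ y ∧ Nonempty (y ≃ Set.Iio α)}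

theorem mk_enumerable_le (α : Ordinal.{u}) :
    #(enumerable α) ≤ 2 ^ (#(Set.Iio α) * #(Set.Iio α)) * #(Set.Iio α) := by
  choose y hy hxy e using fun x : enumerable α => x.2
  let code : enumerable α → Set (Set.Iio α × Set.Iio α) × Set.Iio α := fun x =>
    ({p | ((e x).some.symm p.1).1 ∈ ((e x).some.symm p.2).1}, (e x).some ⟨x.1, hxy x⟩)
  have hinj : Function.Injective code := by
    intro x x' h
    obtain ⟨h₁, h₂⟩ := Prod.mk.inj h
    have := symm_apply_eq_of_mem_iff (hy x) (hy x') (e x).some (e x').some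
      (fun i j => Set.ext_iff.1 h₁ (i, j)) ((e x).some ⟨x.1, hxy x⟩)
    rw [Equiv.symm_apply_apply, h₂, Equiv.symm_apply_apply] at this
    exact Subtype.ext this
  have := mk_le_of_injective hinj
  rwa [mk_prod, Cardinal.lift_id, Cardinal.lift_id, mk_set, mk_prod, Cardinal.lift_id] at this

theorem le_two_powerlt (κ : Cardinal.{u}) : κ ≤ 2 ^< κ :=
  le_of_forall_lt fun c hc => (cantor c).trans_le (le_powerlt 2 hc)

theorem card_H_le {κ : Cardinal.{u}} (h₀ : ℵ₀ ≤ κ) : (H κ).card ≤ 2 ^< κ := by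
  have hκ := le_two_powerlt κ
  have h₁ : ℵ₀ ≤ (2 : Cardinal.{u}) ^< κ := h₀.trans hκ
  have hsub : (H κ : Set ZFSet.{u}) ⊆ ⋃ α : Set.Iio κ.ord, enumerable α.1 := by
    intro x hx
    obtain ⟨y, hy, hxy, hc⟩ := mem_H.1 hx
    have hc' : (insert x y).card < κ := ZFSet.card_insert_le.trans_lt
      (add_lt_of_lt h₀ hc (one_lt_aleph0.trans_le h₀))
    refine Set.mem_iUnion.2 ⟨⟨(insert x y).card.ord, ord_lt_ord.2 hc'⟩, insert x y, ?_,
      ZFSet.mem_insert _ _, ?_⟩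
    · intro z hz t ht
      rcases ZFSet.mem_insert_iff.1 hz with rfl | hz
      · exact ZFSet.mem_insert_of_mem _ (hxy ht)
      · exact ZFSet.mem_insert_of_mem _ (hy.subset_of_mem hz ht)
    · rw [← Cardinal.eq, Cardinal.mk_Iio_ordinal, card_ord, ZFSet.cardinalMk_coe_sort]
  rw [← Cardinal.lift_le.{u + 1}, ← ZFSet.cardinalMk_coe_sort]
  refine (mk_le_mk_of_subset hsub).trans ((mk_iUnion_le_sum_mk).trans
    ((Cardinal.sum_le_sum _ (fun _ => lift.{u + 1} (2 ^< κ)) fun α => ?_).trans ?_))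
  · refine (mk_enumerable_le α.1).trans ?_
    have hα : α.1.card < κ := Cardinal.lt_ord.1 α.2
    rw [Cardinal.mk_Iio_ordinal, ← Cardinal.lift_mul, ← lift_two_power, ← Cardinal.lift_mul,
      Cardinal.lift_le]
    exact mul_le_of_le h₁ (le_powerlt 2 (mul_lt_of_lt h₀ hα hα)) (hα.le.trans hκ)
  · rw [Cardinal.sum_const, Cardinal.mk_Iio_ordinal, card_ord, Cardinal.lift_id, Cardinal.lift_id,
      ← Cardinal.lift_mul, Cardinal.lift_le]
    exact mul_le_of_le h₁ hκ le_rfl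

theorem stationary_mem_H {κ θ : Cardinal.{u}} (hκ : κ.IsRegular) (h₀ : ℵ₀ < κ) (hθ : 2 ^< κ < θ)
    {S : ZFSet.{u}} (hS : IsStationaryIn (H κ) ℵ₀ S) : S ∈ H θ :=
  mem_H.2 ⟨H κ, isTransitive_H κ, fun _ hx => subsetsOfCard_subset_H hκ h₀ (hS.1 hx),
    (card_H_le h₀.le).trans_lt hθ⟩

/-! ### Names for the elements of the reflecting set -/

/-- Terms built from the initial segments of a generic chain and the members of a generic sequence
by `ω₁` binary operations. -/
inductive Name : Type (u + 1)
  | chain (α : CtblOrd.{u}) : Name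
  | fam (α : CtblOrd.{u}) : Name
  | op (ν : CtblOrd.{u}) (s t : Name) : Name

namespace Name

theorem mk_le : #Name.{u} ≤ lift.{u + 1} (ℵ₁ : Cardinal.{u}) := by
  let β : CtblOrd.{u} ⊕ CtblOrd.{u} ⊕ CtblOrd.{u} → Type :=
    Sum.elim (fun _ => Empty) (Sum.elim (fun _ => Empty) fun _ => Bool)
  let f : WType β → Name.{u} := WType.elim Name.{u} fun x => match x with
    | ⟨Sum.inl α, _⟩ => chain α
    | ⟨Sum.inr (Sum.inl α), _⟩ => fam α
    | ⟨Sum.inr (Sum.inr ν), g⟩ => op ν (g false) (g true)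
  have hf : Function.Surjective f := by
    intro t
    induction t with
    | chain α => exact ⟨WType.mk (Sum.inl α) Empty.elim, rfl⟩
    | fam α => exact ⟨WType.mk (Sum.inr (Sum.inl α)) Empty.elim, rfl⟩
    | op ν s t hs ht =>
      obtain ⟨s, rfl⟩ := hs
      obtain ⟨t, rfl⟩ := ht
      exact ⟨WType.mk (Sum.inr (Sum.inr ν)) fun b => cond b t s, rfl⟩
  have : ∀ a, Finite (β a) := by
    rintro (a | a | a)
    · exact inferInstanceAs (Finite Empty)
    · exact inferInstanceAs (Finite Empty)
    · exact inferInstanceAs (Finite Bool)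
  have hℵ : (ℵ₀ : Cardinal.{u + 1}) ≤ lift.{u + 1} (ℵ₁ : Cardinal.{u}) := by
    rw [← Cardinal.lift_aleph0.{u + 1, u}, Cardinal.lift_le]
    exact aleph0_le_aleph 1
  refine (mk_le_of_surjective hf).trans
    ((WType.cardinalMk_le_max_aleph0_of_finite' (β := β)).trans (max_le ?_ hℵ))
  simp only [mk_sum, Cardinal.lift_id, mk_ctblOrd]
  rw [add_eq_self, add_eq_self]
  all_goals simp

variable (E : ZFSet.{u} → ZFSet.{u} → CtblOrd.{u} → ZFSet.{u})

/-- The value of a name. -/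
def eval (Q S : Ordinal.{u} → ZFSet.{u}) : Name.{u} → ZFSet.{u}
  | chain α => seq α.1 Q
  | fam α => S α.1
  | op ν s t => E (eval Q S s) (eval Q S t) ν

/-- A bound for the indices that matter for the value of a name. -/
def bound : Name.{u} → Ordinal.{u}
  | chain α => α.1
  | fam α => α.1 + 1
  | op _ s t => max (bound s) (bound t)

theorem bound_lt (t : Name.{u}) : t.bound < ω₁ := by
  induction t with
  | chain α => exact α.2
  | fam α => exact (isSuccLimit_omega 1).add_one_lt α.2
  | op ν s t hs ht => exact max_lt hs ht

theorem eval_congr {Q S Q' S' : Ordinal.{u} → ZFSet.{u}} (t : Name.{u})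
    (hQ : ∀ i < t.bound, Q i = Q' i) (hS : ∀ i < t.bound, S i = S' i) :
    t.eval E Q S = t.eval E Q' S' := by
  induction t with
  | chain α => exact seq_congr hQ
  | fam α => exact hS _ (lt_add_one_iff.2 le_rfl)
  | op ν s t hs ht =>
    simp only [bound, lt_max_iff] at hQ hS
    simp only [eval]
    rw [hs (fun i hi => hQ i (Or.inl hi)) (fun i hi => hS i (Or.inl hi)),
      ht (fun i hi => hQ i (Or.inr hi)) (fun i hi => hS i (Or.inr hi))]

end Name

/-! ### The generic diagonal chain -/

/-- The condition given by `δ, l, Q, S` decides the name `t`, and it puts its value into `⋃ Q` if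
the value is in `H_κ`, and into the range of `S` if the value is in `𝒮`. -/
structure Captures (κ : Cardinal.{u}) (𝒮 : ZFSet.{u})
    (E : ZFSet.{u} → ZFSet.{u} → CtblOrd.{u} → ZFSet.{u}) (t : Name.{u}) (δ l : Ordinal.{u})
    (Q S : Ordinal.{u} → ZFSet.{u}) : Prop where
  bound_le₁ : t.bound ≤ δ
  bound_le₂ : t.bound ≤ l
  union : t.eval E Q S ∈ H κ → ∃ α ≤ δ, t.eval E Q S ∈ Q α
  range : t.eval E Q S ∈ 𝒮 → ∃ i < l, S i = t.eval E Q S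

theorem isDense_captures {κ : Cardinal.{u}} (hκ : κ.IsRegular) (h₀ : ℵ₀ < κ)
    {𝒮 : ZFSet.{u}} {T : CtblOrd.{u} → Set CtblOrd.{u}} (hne : 𝒮.Nonempty)
    (h𝒮 : IsStationaryFamily κ 𝒮) (hT : IsDisjointStationarySeq T)
    (E : ZFSet.{u} → ZFSet.{u} → CtblOrd.{u} → ZFSet.{u}) (t : Name.{u}) :
    (dsrpForcing κ 𝒮 T).IsDense {p | ∃ δ l Q S, IsConditionData κ 𝒮 T δ l Q S ∧
      p.1 = condition δ l Q S ∧ Captures κ 𝒮 E t δ l Q S} := by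
  intro p
  obtain ⟨s₀, hs₀⟩ := hne
  have hempty := empty_mem_H hκ.pos
  obtain ⟨q, δ, l, Q, S, hqp, hq, hqe, hδ, hl, -, -⟩ :=
    exists_extension hκ h₀ h𝒮 hT p t.bound_lt hempty hs₀
  obtain ⟨a, ha, hav⟩ : ∃ a ∈ H κ, t.eval E Q S ∈ H κ → a = t.eval E Q S := by
    by_cases h : t.eval E Q S ∈ H κ
    exacts [⟨_, h, fun _ => rfl⟩, ⟨_, hempty, fun h' => absurd h' h⟩]
  obtain ⟨s, hs, hsv⟩ : ∃ s ∈ 𝒮, t.eval E Q S ∈ 𝒮 → s = t.eval E Q S := by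
    by_cases h : t.eval E Q S ∈ 𝒮
    exacts [⟨_, h, fun _ => rfl⟩, ⟨_, hs₀, fun h' => absurd h' h⟩]
  obtain ⟨r, δ', l', Q', S', hrq, hr, hre, hδ', hl', hau, hsr⟩ :=
    exists_extension hκ h₀ h𝒮 hT q t.bound_lt ha hs
  obtain ⟨hQ, hS⟩ := (dsrpForcing_le_iff hqe hre).1 hrq
  have e : t.eval E Q S = t.eval E Q' S' := t.eval_congr E
    (fun i hi => (hQ i (lt_add_one_iff.2 (hi.le.trans hδ))).2) (fun i hi => (hS i (hi.trans_le hl)).2)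
  rw [e] at hav hsv
  exact ⟨r, ⟨δ', l', Q', S', hr, hre, hδ', hl', fun h => hav h ▸ hau, fun h => hsv h ▸ hsr⟩,
    (dsrpForcing κ 𝒮 T).trans _ _ _ hrq hqp⟩

theorem filter_compat {κ : Cardinal.{u}} {𝒮 : ZFSet.{u}} {T : CtblOrd.{u} → Set CtblOrd.{u}}
    {F : Set (dsrpForcing κ 𝒮 T).carrier} (hF : (dsrpForcing κ 𝒮 T).IsFilter F)
    {p q : (dsrpForcing κ 𝒮 T).carrier} (hpF : p ∈ F) (hqF : q ∈ F) {δ l δ' l' : Ordinal.{u}}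
    {Q S Q' S' : Ordinal.{u} → ZFSet.{u}} (hp : p.1 = condition δ l Q S)
    (hq : q.1 = condition δ' l' Q' S') :
    (∀ i ≤ δ, i ≤ δ' → Q i = Q' i) ∧ ∀ i < l, i < l' → S i = S' i := by
  obtain ⟨r, -, hrp, hrq⟩ := hF.directed p hpF q hqF
  obtain ⟨δ'', l'', Q'', S'', -, hr⟩ := mem_conditions.1 r.2
  obtain ⟨h₁, h₂⟩ := (dsrpForcing_le_iff hp hr).1 hrp
  obtain ⟨h₃, h₄⟩ := (dsrpForcing_le_iff hq hr).1 hrq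
  exact ⟨fun i hi hi' => (h₁ i (lt_add_one_iff.2 hi)).2.trans (h₃ i (lt_add_one_iff.2 hi')).2.symm,
    fun i hi hi' => (h₂ i hi).2.trans (h₄ i hi').2.symm⟩

/-- `⟨Q, S⟩` is the union of a system of conditions that capture all names. -/
def IsGeneric (κ : Cardinal.{u}) (𝒮 : ZFSet.{u}) (T : CtblOrd.{u} → Set CtblOrd.{u})
    (E : ZFSet.{u} → ZFSet.{u} → CtblOrd.{u} → ZFSet.{u}) (Q S : Ordinal.{u} → ZFSet.{u}) : Prop :=
  ∀ t : Name.{u}, ∃ δ l, IsConditionData κ 𝒮 T δ l Q S ∧ Captures κ 𝒮 E t δ l Q S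

theorem IsConditionData.congr {κ : Cardinal.{u}} {𝒮 : ZFSet.{u}}
    {T : CtblOrd.{u} → Set CtblOrd.{u}} {δ l : Ordinal.{u}} {Q S Q' S' : Ordinal.{u} → ZFSet.{u}}
    (h : IsConditionData κ 𝒮 T δ l Q S) (hQ : ∀ i ≤ δ, Q i = Q' i) (hS : ∀ i < l, S i = S' i) :
    IsConditionData κ 𝒮 T δ l Q' S' := by
  refine ⟨h.lt₁, h.lt₂, fun α hα => hQ α hα ▸ h.mem α hα, ⟨fun i hi => ?_, fun m hm hl x => ?_⟩,
    fun i hi => hS i hi ▸ h.mem_family i hi, fun α i hα hi => ?_⟩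
  · have hi' := lt_add_one_iff.1 hi
    rw [← hQ _ hi', ← hQ i ((le_succ i).trans hi')]
    exact h.chain.1 i hi
  · have hm' := lt_add_one_iff.1 hm
    rw [← hQ m hm', h.chain.2 m hm hl x]
    refine exists_congr fun i => and_congr_right fun hi => ?_
    rw [hQ i (hi.le.trans hm')]
  · obtain ⟨h₁, h₂⟩ := h.diagonal α i hα hi
    rw [← hQ _ hα, ← hS _ h₁]
    exact ⟨h₁, h₂⟩

theorem Captures.congr {κ : Cardinal.{u}} {𝒮 : ZFSet.{u}}
    {E : ZFSet.{u} → ZFSet.{u} → CtblOrd.{u} → ZFSet.{u}} {t : Name.{u}} {δ l : Ordinal.{u}}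
    {Q S Q' S' : Ordinal.{u} → ZFSet.{u}} (h : Captures κ 𝒮 E t δ l Q S)
    (hQ : ∀ i ≤ δ, Q i = Q' i) (hS : ∀ i < l, S i = S' i) : Captures κ 𝒮 E t δ l Q' S' := by
  have e : t.eval E Q S = t.eval E Q' S' := t.eval_congr E
    (fun i hi => hQ i (hi.le.trans h.bound_le₁)) (fun i hi => hS i (hi.trans_le h.bound_le₂))
  refine ⟨h.bound_le₁, h.bound_le₂, fun h' => ?_, fun h' => ?_⟩
  · obtain ⟨α, hα, hm⟩ := h.union (e ▸ h')
    exact ⟨α, hα, by rwa [← e, ← hQ α hα]⟩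
  · obtain ⟨i, hi, hm⟩ := h.range (e ▸ h')
    exact ⟨i, hi, by rw [← e, ← hS i hi, hm]⟩

theorem exists_isGeneric {κ : Cardinal.{u}} (hκ : κ.IsRegular) (h₀ : ℵ₀ < κ)
    {𝒮 : ZFSet.{u}} {T : CtblOrd.{u} → Set CtblOrd.{u}} (hne : 𝒮.Nonempty)
    (h𝒮 : IsStationaryFamily κ 𝒮) (hT : IsDisjointStationarySeq T)
    (hFA : FA {dsrpForcing κ 𝒮 T}) (E : ZFSet.{u} → ZFSet.{u} → CtblOrd.{u} → ZFSet.{u}) :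
    ∃ Q S, IsGeneric κ 𝒮 T E Q S := by
  have : Nonempty Name.{u} := ⟨Name.chain ⟨0, omega_pos 1⟩⟩
  obtain ⟨nm, hnm⟩ := exists_surjective_ctblOrd Name.mk_le
  have hP : (dsrpForcing κ 𝒮 T).carrier.Nonempty := by
    obtain ⟨δ, l, Q, S, h⟩ := exists_conditionData hne h𝒮 hT
    exact ⟨_, mem_conditions.2 ⟨δ, l, Q, S, h, rfl⟩⟩
  obtain ⟨F, hF, hFD⟩ := hFA _ rfl hP _ fun i => isDense_captures hκ h₀ hne h𝒮 hT E (nm i)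
  have hD : ∀ t : Name.{u}, ∃ p ∈ F, ∃ δ l Q S, IsConditionData κ 𝒮 T δ l Q S ∧
      p.1 = condition δ l Q S ∧ Captures κ 𝒮 E t δ l Q S := by
    intro t
    obtain ⟨i, rfl⟩ := hnm t
    obtain ⟨p, hp, h⟩ := hFD i
    exact ⟨p, hp, h⟩
  choose p hpF δ l Q S hdata hpe hcap using hD
  have hj : ∀ α : Ordinal.{u}, ∃ t : Name.{u}, α < ω₁ → t.bound = α + 1 := fun α => by
    by_cases h : α < ω₁
    · exact ⟨Name.fam ⟨α, h⟩, fun _ => rfl⟩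
    · exact ⟨Classical.arbitrary _, fun h' => absurd h' h⟩
  choose j hj using hj
  have hlt : ∀ α < ω₁, α < δ (j α) ∧ α < l (j α) := fun α hα => by
    have h₁ := (hcap (j α)).bound_le₁
    have h₂ := (hcap (j α)).bound_le₂
    rw [hj α hα] at h₁ h₂
    exact ⟨lt_of_lt_of_le (lt_add_one_iff.2 le_rfl) h₁, lt_of_lt_of_le (lt_add_one_iff.2 le_rfl) h₂⟩
  have hQ : ∀ t, ∀ i ≤ δ t, Q t i = Q (j i) i := fun t i hi =>
    (filter_compat hF (hpF _) (hpF _) (hpe _) (hpe _)).1 i hi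
      (hlt i (hi.trans_lt (hdata t).lt₁)).1.le
  have hS : ∀ t, ∀ i < l t, S t i = S (j i) i := fun t i hi =>
    (filter_compat hF (hpF _) (hpF _) (hpe _) (hpe _)).2 i hi
      (hlt i (hi.trans (hdata t).lt₂)).2
  exact ⟨fun α => Q (j α) α, fun α => S (j α) α, fun t => ⟨δ t, l t,
    (hdata t).congr (hQ t) (hS t), (hcap t).congr (hQ t) (hS t)⟩⟩

theorem IsGeneric.exists_data {κ : Cardinal.{u}} {𝒮 : ZFSet.{u}}
    {T : CtblOrd.{u} → Set CtblOrd.{u}} {E : ZFSet.{u} → ZFSet.{u} → CtblOrd.{u} → ZFSet.{u}}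
    {Q S : Ordinal.{u} → ZFSet.{u}} (h : IsGeneric κ 𝒮 T E Q S) {α : Ordinal.{u}} (hα : α < ω₁) :
    ∃ δ l, IsConditionData κ 𝒮 T δ l Q S ∧ α < δ ∧ α < l := by
  obtain ⟨δ, l, hd, hc⟩ := h (Name.fam ⟨α, hα⟩)
  exact ⟨δ, l, hd, lt_of_lt_of_le (lt_add_one_iff.2 le_rfl) hc.bound_le₁, lt_of_lt_of_le (lt_add_one_iff.2 le_rfl) hc.bound_le₂⟩

/-- A generic pair is a diagonal chain up to the set of values of names, provided that set contains
all its countable elements as subsets. -/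
theorem IsGeneric.isDiagonalChain {κ : Cardinal.{u}} (hκ : κ.IsRegular) (h₀ : ℵ₀ < κ)
    {𝒮 : ZFSet.{u}} {T : CtblOrd.{u} → Set CtblOrd.{u}}
    {E : ZFSet.{u} → ZFSet.{u} → CtblOrd.{u} → ZFSet.{u}}
    {Q S : Ordinal.{u} → ZFSet.{u}} (h : IsGeneric κ 𝒮 T E Q S) {X : ZFSet.{u}}
    (hX : ∀ x, x ∈ X ↔ ∃ t : Name.{u}, t.eval E Q S = x)
    (hsub : ∀ x ∈ X, x.card ≤ ℵ₀ → x ⊆ X) : IsDiagonalChain κ 𝒮 T X Q S := by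
  have hω : ∀ α < ω₁, α + 1 < (ω₁ : Ordinal.{u}) := fun α => (isSuccLimit_omega 1).add_one_lt
  have hQ : ∀ i < ω₁, Q i ∈ subsetsOfCard (H κ) ℵ₀ := fun i hi => by
    obtain ⟨δ, l, hd, hiδ, -⟩ := h.exists_data hi
    exact hd.mem i hiδ.le
  have hseq : ∀ i < ω₁, seq i Q ∈ X := fun i hi => (hX _).2 ⟨Name.chain ⟨i, hi⟩, rfl⟩
  have hseqc : ∀ i < ω₁, (seq i Q).card ≤ ℵ₀ := fun i hi => card_range_le (by
    rw [Cardinal.mk_Iio_ordinal, Cardinal.lift_lift, Cardinal.lift_le]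
    exact card_lt_aleph_one hi)
  have hQX : ∀ i < ω₁, Q i ⊆ X := fun i hi => by
    have h₁ : ZFSet.pair i.toZFSet (Q i) ∈ X := hsub _ (hseq _ (hω i hi)) (hseqc _ (hω i hi))
      (mem_seq.2 ⟨i, lt_add_one_iff.2 le_rfl, rfl⟩)
    have h₂ : ({i.toZFSet, Q i} : ZFSet.{u}) ∈ X :=
      hsub _ h₁ card_pair_le (ZFSet.mem_pair.2 (Or.inr rfl))
    exact hsub _ (hsub _ h₂ card_pair_le (ZFSet.mem_pair.2 (Or.inr rfl)))
      (mem_subsetsOfCard.1 (hQ i hi)).2.le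
  refine ⟨fun i hi => ?_, ⟨fun i hi => ?_, fun m hm hl => ?_⟩, fun i hi => ?_, fun i j hij => ?_,
    fun x => ?_, fun i hi => ?_, fun s => ?_⟩
  · exact ⟨(mem_subsetsOfCard.1 (hQ i hi)).1, (mem_subsetsOfCard.1 (hQ i hi)).2.le⟩
  · obtain ⟨δ, l, hd, hiδ, -⟩ := h.exists_data hi
    exact hd.chain.1 i (hiδ.trans (lt_add_one_iff.2 le_rfl))
  · obtain ⟨δ, l, hd, hmδ, -⟩ := h.exists_data hm
    exact hd.chain.2 m (hmδ.trans (lt_add_one_iff.2 le_rfl)) hl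
  · obtain ⟨δ, l, hd, -, hil⟩ := h.exists_data hi
    exact hd.mem_family i hil
  · obtain ⟨δ, l, hd, hiδ, -⟩ := h.exists_data i.2
    exact (hd.diagonal i j hiδ.le hij).2
  · rw [ZFSet.mem_inter]
    constructor
    · rintro ⟨hxH, hxX⟩
      obtain ⟨t, rfl⟩ := (hX x).1 hxX
      obtain ⟨δ, l, hd, hc⟩ := h t
      obtain ⟨α, hα, hm⟩ := hc.union hxH
      exact ⟨α, hα.trans_lt hd.lt₁, hm⟩
    · rintro ⟨i, hi, hxi⟩
      exact ⟨(mem_subsetsOfCard.1 (hQ i hi)).1 hxi, hQX i hi hxi⟩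
  · exact ZFSet.mem_inter.2 ⟨seq_mem_H hκ h₀ hi fun k hk =>
      subsetsOfCard_subset_H hκ h₀ (hQ k (hk.trans hi)), hseq i hi⟩
  · rw [ZFSet.mem_inter]
    constructor
    · rintro ⟨hs, hsX⟩
      obtain ⟨t, rfl⟩ := (hX s).1 hsX
      obtain ⟨δ, l, hd, hc⟩ := h t
      obtain ⟨i, hi, hm⟩ := hc.range hs
      exact ⟨i, hi.trans hd.lt₂, hm⟩
    · rintro ⟨i, hi, rfl⟩
      obtain ⟨δ, l, hd, -, hil⟩ := h.exists_data hi
      exact ⟨hd.mem_family i hil, (hX _).2 ⟨Name.fam ⟨i, hi⟩, rfl⟩⟩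

theorem dsrp_of_FA {κ : Cardinal.{u}} (hκ : κ.IsRegular) (h₁ : ℵ₁ < κ)
    {𝒮 : ZFSet.{u}} {T : CtblOrd.{u} → Set CtblOrd.{u}} (hne : 𝒮.Nonempty)
    (h𝒮 : IsStationaryFamily κ 𝒮) (hT : IsDisjointStationarySeq T)
    (hFA : FA {dsrpForcing κ 𝒮 T}) : DSRP κ 𝒮 T := by
  classical
  intro θ hθ hκθ
  refine ⟨ZFSet.sep_subset, fun C hC => ?_⟩
  have h₀ : ℵ₀ < κ := (aleph0_le_aleph 1).trans_lt h₁
  have hκθ' : κ < θ := (le_two_powerlt κ).trans_lt hκθ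
  have hω₁ : (ω₁ : Ordinal.{u}).toZFSet ∈ subsetsOfCard (H θ) ℵ₁ := by
    refine mem_subsetsOfCard.2 ⟨fun x hx => ?_, by rw [Ordinal.card_toZFSet, card_omega]⟩
    obtain ⟨α, hα, rfl⟩ := Ordinal.mem_toZFSet_iff.1 hx
    exact toZFSet_mem_H ((card_lt_aleph_one hα).trans_lt (h₀.trans hκθ'))
  have hω₁' := mem_subsetsOfCard.1 hω₁
  obtain ⟨F, hF, hFC⟩ := hC.exists_closed_imp_mem ⟨_, hω₁⟩
    fun a ha b hb => pair_mem_H hθ (h₀.trans hκθ') ha hb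
  let F' : ZFSet.{u} → ZFSet.{u} → ZFSet.{u} := fun s t => F s t ∪
    ((ω₁ : Ordinal.{u}).toZFSet ∪ if s ∈ H θ ∧ s.card ≤ ℵ₀ then s else ∅)
  have hℵ : (ℵ₀ : Cardinal.{u}) ≤ ℵ₁ := aleph0_le_aleph 1
  have hF'A : ∀ s t, F' s t ⊆ H θ := by
    intro s t x hx
    rcases ZFSet.mem_union.1 hx with hx | hx
    · exact (hF s t).1 hx
    · rcases ZFSet.mem_union.1 hx with hx | hx
      · exact hω₁'.1 hx
      · split_ifs at hx with h
        · exact (isTransitive_H θ).subset_of_mem h.1 hx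
        · exact absurd hx (ZFSet.notMem_empty x)
  have hF'c : ∀ s t, (F' s t).card ≤ ℵ₁ := by
    intro s t
    refine ZFSet.card_union_le.trans (add_le_of_le hℵ (hF s t).2
      (ZFSet.card_union_le.trans (add_le_of_le hℵ hω₁'.2.le ?_)))
    split_ifs with h
    · exact h.2.trans hℵ
    · simp
  have hF'ω : ∀ s t, (ω₁ : Ordinal.{u}).toZFSet ⊆ F' s t := fun s t x hx =>
    ZFSet.mem_union.2 (Or.inr (ZFSet.mem_union.2 (Or.inl hx)))
  have hE : ∀ s t, ∃ e : CtblOrd.{u} → F' s t, Function.Surjective e := by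
    intro s t
    have : Nonempty (F' s t) :=
      ⟨⟨_, hF'ω s t (Ordinal.toZFSet_mem_toZFSet_iff.2 (omega_pos 1))⟩⟩
    refine exists_surjective_ctblOrd ?_
    rw [ZFSet.cardinalMk_coe_sort, Cardinal.lift_le]
    exact hF'c s t
  choose E hE using hE
  obtain ⟨Q, S, hgen⟩ := exists_isGeneric hκ h₀ hne h𝒮 hT hFA fun s t ν => (E s t ν).1
  set E' : ZFSet.{u} → ZFSet.{u} → CtblOrd.{u} → ZFSet.{u} := fun s t ν => (E s t ν).1
  have : Nonempty Name.{u} := ⟨Name.chain ⟨0, omega_pos 1⟩⟩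
  obtain ⟨nm, hnm⟩ := exists_surjective_ctblOrd Name.mk_le
  let X : ZFSet.{u} := ZFSet.range fun i : CtblOrd.{u} => (nm i).eval E' Q S
  have hX : ∀ x, x ∈ X ↔ ∃ t : Name.{u}, t.eval E' Q S = x := fun x => by
    rw [ZFSet.mem_range, hnm.exists]
  have hXA : X ⊆ H θ := by
    intro x hx
    obtain ⟨t, rfl⟩ := (hX x).1 hx
    cases t with
    | chain α =>
      refine H_mono hκθ'.le (seq_mem_H hκ h₀ α.2 fun i hi => ?_)
      obtain ⟨δ, l, hd, hiδ, -⟩ := hgen.exists_data (hi.trans α.2)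
      exact subsetsOfCard_subset_H hκ h₀ (hd.mem i hiδ.le)
    | fam α =>
      obtain ⟨δ, l, hd, -, hαl⟩ := hgen.exists_data α.2
      exact stationary_mem_H hκ h₀ hκθ (h𝒮 _ (hd.mem_family _ hαl))
    | op ν s t => exact hF'A _ _ (E _ _ ν).2
  have hcl : ∀ s ∈ X, ∀ t ∈ X, F' s t ⊆ X := by
    intro s hs t ht x hx
    obtain ⟨s, rfl⟩ := (hX s).1 hs
    obtain ⟨t, rfl⟩ := (hX t).1 ht
    obtain ⟨ν, hν⟩ := hE _ _ ⟨x, hx⟩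
    exact (hX x).2 ⟨Name.op ν s t, congrArg Subtype.val hν⟩
  have hXne : X.Nonempty := ⟨_, (hX _).2 ⟨Name.chain ⟨0, omega_pos 1⟩, rfl⟩⟩
  have hXc : X.card ≤ ℵ₁ := card_range_le (by
    rw [mk_ctblOrd, Cardinal.lift_lift, Cardinal.lift_le.{u + 1}])
  have hXC : X ∈ C := hFC X hXA hXne hXc fun s hs t ht x hx =>
    hcl s hs t ht (ZFSet.mem_union.2 (Or.inl hx))
  obtain ⟨x₀, hx₀⟩ := hXne
  refine ⟨X, ZFSet.mem_sep.2 ⟨hC.subset hXC, (hF'ω x₀ x₀).trans (hcl _ hx₀ _ hx₀), Q, S,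
    hgen.isDiagonalChain hκ h₀ hX fun x hx hc y hy => hcl x hx x hx ?_⟩, hXC⟩
  refine ZFSet.mem_union.2 (Or.inr (ZFSet.mem_union.2 (Or.inr ?_)))
  rwa [if_pos ⟨hXA hx, hc⟩]

end

end DiagRefl

theorem mainTheorem6 :
    -- `FA(Γ)` implies `Γ`-`DSRP`
    (∀ Γ : Set DiagRefl.ForcingNotion.{u}, DiagRefl.FA Γ → DiagRefl.FragmentDSRP Γ) ∧
    -- the forcing axiom for the single forcing notion implies `DSRP(𝒮, T)`
    (∀ (κ : Cardinal.{u}) (𝒮 : ZFSet.{u})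
        (T : DiagRefl.CtblOrd.{u} → Set DiagRefl.CtblOrd.{u}),
      κ.IsRegular → ℵ₁ < κ → 𝒮.Nonempty → DiagRefl.IsStationaryFamily κ 𝒮 →
      DiagRefl.IsDisjointStationarySeq T →
      DiagRefl.FA {DiagRefl.dsrpForcing κ 𝒮 T} → DiagRefl.DSRP κ 𝒮 T) ∧
    -- the density properties of the forcing notion
    (∀ (κ : Cardinal.{u}) (𝒮 : ZFSet.{u})
        (T : DiagRefl.CtblOrd.{u} → Set DiagRefl.CtblOrd.{u}),
      κ.IsRegular → ℵ₀ < κ → 𝒮.Nonempty → DiagRefl.IsStationaryFamily κ 𝒮 →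
      DiagRefl.IsDisjointStationarySeq T →
      (∀ γ < ω₁, (DiagRefl.dsrpForcing κ 𝒮 T).IsDense
        {p | ∃ δ l Q S, DiagRefl.IsConditionData κ 𝒮 T δ l Q S ∧
          p.1 = DiagRefl.condition δ l Q S ∧ γ ≤ δ ∧ γ ≤ l}) ∧
      (∀ a ∈ DiagRefl.H κ, (DiagRefl.dsrpForcing κ 𝒮 T).IsDense
        {p | ∃ δ l Q S, DiagRefl.IsConditionData κ 𝒮 T δ l Q S ∧
          p.1 = DiagRefl.condition δ l Q S ∧ ∃ α ≤ δ, a ∈ Q α}) ∧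
      (∀ s ∈ 𝒮, (DiagRefl.dsrpForcing κ 𝒮 T).IsDense
        {p | ∃ δ l Q S, DiagRefl.IsConditionData κ 𝒮 T δ l Q S ∧
          p.1 = DiagRefl.condition δ l Q S ∧ ∃ i < l, S i = s})) := by
  have h₂ := fun (κ : Cardinal.{u}) (𝒮 : ZFSet.{u})
      (T : DiagRefl.CtblOrd.{u} → Set DiagRefl.CtblOrd.{u}) (hκ : κ.IsRegular) (h₁ : ℵ₁ < κ)
      (hne : 𝒮.Nonempty) (h𝒮 : DiagRefl.IsStationaryFamily κ 𝒮)
      (hT : DiagRefl.IsDisjointStationarySeq T)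
      (hFA : DiagRefl.FA {DiagRefl.dsrpForcing κ 𝒮 T}) =>
    DiagRefl.dsrp_of_FA hκ h₁ hne h𝒮 hT hFA
  refine ⟨fun Γ hΓ κ hκ h₁ 𝒮 T ⟨hne, h𝒮, hT, hP⟩ => h₂ κ 𝒮 T hκ h₁ hne h𝒮 hT fun P hP' =>
    hΓ P (hP' ▸ hP), h₂, fun κ 𝒮 T hκ h₀ hne h𝒮 hT => ?_⟩
  have hext := @DiagRefl.exists_extension κ hκ h₀ 𝒮 T h𝒮 hT
  obtain ⟨s₀, hs₀⟩ := hne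
  have hempty := DiagRefl.empty_mem_H hκ.pos
  refine ⟨fun γ hγ p => ?_, fun a ha p => ?_, fun s hs p => ?_⟩
  · obtain ⟨q, δ, l, Q, S, hqp, hq, hqe, hδ, hl, -, -⟩ := hext p hγ hempty hs₀
    exact ⟨q, ⟨δ, l, Q, S, hq, hqe, hδ, hl⟩, hqp⟩
  · obtain ⟨q, δ, l, Q, S, hqp, hq, hqe, -, -, h, -⟩ := hext p (omega_pos 1) ha hs₀
    exact ⟨q, ⟨δ, l, Q, S, hq, hqe, h⟩, hqp⟩
  · obtain ⟨q, δ, l, Q, S, hqp, hq, hqe, -, -, -, h⟩ := hext p (omega_pos 1) hempty hs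
    exact ⟨q, ⟨δ, l, Q, S, hq, hqe, h⟩, hqp⟩
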